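/- **Proposition (statistical stability).** *Medium.* Let a homogeneous medium with wave speed $c>0$ contain a dipole source at $x_s\in\mathbb R^3$ and finitely many point scatterers at $y_1,\dots,y_N\in\mathbb R^3\setminus\{x_s\}$ with complex symmetric $3\times3$ polarizability tensors $\alpha_n(\omega)$, measurable in $\omega$ and satisfying $\alpha_n(-\omega)=\overline{\alpha_n(\omega)}$ for $\omega>0$ (for instance, constant on $\omega>0$). Let $$G(x,y;k)=\frac{e^{ikr}}{4\pi r}\Big[(1+m(kr))I-(1+3m(kr))\frac{\mathbf r\mathbf r^{\top}}{r^2}\Big],\quad \mathbf r=x-y,\ r=|\mathbf r|,\ m(s)=\frac{is-1}{s^2},$$ be the dyadic Green function. In the first Born approximation the total electric field at $x_r$ is, in the frequency domain, $E(x_r,\omega)=\mathcal G(x_r,\omega)\,j_s(\omega)$ with $$\mathcal G(x_r,\omega)=G(x_r,x_s;\omega/c)+\sum_{n=1}^N G(x_r,y_n;\omega/c)\,\alpha_n(\omega)\,G(y_n,x_s;\omega/c).$$ Time and frequency domain are related by $f(t)=\int f(\omega)e^{-i\omega t}\,d\omega$. *Source.* Let $U_s$ be a real $3\times2$ matrix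 with orthonormal columns. Let $\widetilde J_s(\omega)$ be Hermitian positive semidefinite $2\times2$ matrices, integrable in $\omega\in\mathbb R$, with $\widetilde J_s(-\omega)=\overline{\widetilde J_s(\omega)}$. Let $j_s(t)\in\mathbb R^3$ be a (stationary) real Gaussian process with $$\langle j_s(t)\rangle=0,\qquad \langle j_s(t+\tau)j_s(t)^{\top}\rangle=U_s\Big(\int e^{-i\omega\tau}\widetilde J_s(\omega)\,d\omega\Big)U_s^*.$$ *Field.* Let $x_r\in\mathbb R^3\setminus\{x_s,y_1,\dots,y_N\}$, and let $E(x_r,t)\in\mathbb R^3$, jointly measurable in $t$ and the random parameter, be the Born field $E(x_r,t)=\int e^{-i\omega t}\mathcal G(x_r,\omega)j_s(\omega)\,d\omega$. Here $\int f(\omega)\cdot j_s(\omega)\,d\omega$ is the mean square stochastic integral: the continuous linear extension of $\sum_k e^{-i\omega s_k}a_k\mapsto\sum_k a_k\cdot j_s(s_k)$ from the norm $\big(\int f\,U_s\widetilde J_sU_s^*f^*\,d\omega\big)^{1/2}$ to $L^2$ of the probability space. *Data.* With $U_\parallel=[e_1,e_2]$, let $$\psi(x_r,\omega)=U_\parallel^*\,\mathcal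 G(x_r,\omega)\,U_s\widetilde J_s(\omega)U_s^*\,\mathcal G(x_r,\omega)^*\,U_\parallel$$ be the coherency matrix data, and assume that its diagonal entries are square integrable over $\omega\in\mathbb R$. For $T>0$ and $\tau\in\mathbb R$ let $$\psi_{emp}(x_r,\tau)=\frac1{2T}\int_{-T}^{T}U_\parallel^*E(x_r,t+\tau)E(x_r,t)^{\top}U_\parallel\,dt .$$ *Conclusion.* For every $\tau\in\mathbb R$, entry by entry, $\psi(x_r,\cdot)$ is integrable. For every $T>0$ the integral defining $\psi_{emp}(x_r,\tau)$ exists almost surely, $\psi_{emp}(x_r,\tau)$ has finite second moment, and its mean is independent of $T$: $$\langle\psi_{emp}(x_r,\tau)\rangle=\int e^{-i\omega\tau}\,\psi(x_r,\omega)\,d\omega .$$ Moreover the variance of each entry of $\psi_{emp}(x_r,\tau)$ is $O(1/T)$ as $T\to\infty$, and $$\psi_{emp}(x_r,\tau)\to\int e^{-i\omega\tau}\,\psi(x_r,\omega)\,d\omega\qquad (T\to\infty)$$ in mean square and in probability. -/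

import Mathlib

open MeasureTheory ProbabilityTheory Filter Topology Matrix
open scoped ENNReal ComplexOrder

noncomputable section

namespace StatStab

/-- Positions in three dimensional space, with the Euclidean norm. -/
abbrev Point : Type := EuclideanSpace ℝ (Fin 3)

/-- The factor `m(s) = (i s - 1) / s²` occurring in the dyadic Green function. -/
def mFactor (s : ℝ) : ℂ := (Complex.I * s - 1) / (s : ℂ) ^ 2

/-- The scalar Green function `exp(i k r) / (4 π r)` of the 3D Helmholtz equation, `r = |x - y|`. -/
def scalarGreen (x y : Point) (k : ℝ) : ℂ :=
  Complex.exp (Complex.I * k * ‖x - y‖) / (4 * Real.pi * ‖x - y‖)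

/-- The dyadic Green function
`G(x,y;k) [ (1 + m(kr)) I - (1 + 3 m(kr)) r rᵀ / r² ]`, with `r = x - y`. -/
def dyadicGreen (x y : Point) (k : ℝ) : Matrix (Fin 3) (Fin 3) ℂ :=
  scalarGreen x y k •
    ((1 + mFactor (k * ‖x - y‖)) • (1 : Matrix (Fin 3) (Fin 3) ℂ)
      - ((1 + 3 * mFactor (k * ‖x - y‖)) / ((‖x - y‖ : ℝ) : ℂ) ^ 2) •
        Matrix.of fun i j : Fin 3 => (((x - y) i * (x - y) j : ℝ) : ℂ))

/-- A homogeneous medium with wave speed `c`, a dipole source at `xs` and `N` point scatterers at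
`y n` with (rescaled) symmetric polarizability tensors `α n ω`.  The reflection principle
`α n (-ω) = conj (α n ω)` expresses that time domain fields are real; a tensor that does not depend
on the (positive) frequency is the special case where `α n` is constant on `ω > 0`. -/
structure Scene where
  c : ℝ
  c_pos : 0 < c
  xs : Point
  N : ℕ
  y : Fin N → Point
  y_ne_xs : ∀ n, y n ≠ xs
  α : Fin N → ℝ → Matrix (Fin 3) (Fin 3) ℂ
  α_symm : ∀ n ω, (α n ω)ᵀ = α n ω
  α_reflection : ∀ n ω, 0 < ω → ∀ i j, α n (-ω) i j = star (α n ω i j)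
  α_measurable : ∀ n i j, Measurable fun ω => α n ω i j

/-- The array response `Π(x, xs; ω/c) = ∑ₙ G(x, yₙ; ω/c) αₙ(ω) G(yₙ, xs; ω/c)`. -/
def Scene.response (S : Scene) (x : Point) (ω : ℝ) : Matrix (Fin 3) (Fin 3) ℂ :=
  ∑ n, dyadicGreen x (S.y n) (ω / S.c) * S.α n ω * dyadicGreen (S.y n) S.xs (ω / S.c)

/-- The transfer matrix `G + Π` of the first Born approximation: in the frequency domain the total
field at `x` is this matrix applied to the source polarization vector `j_s(ω)`. -/
def Scene.bornTransfer (S : Scene) (x : Point) (ω : ℝ) : Matrix (Fin 3) (Fin 3) ℂ :=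
  dyadicGreen x S.xs (ω / S.c) + S.response x ω

/-- `U_∥ = [e₁, e₂]`, the cross-range directions. -/
def Upar : Matrix (Fin 3) (Fin 2) ℝ := !![1, 0; 0, 1; 0, 0]

/-- A real matrix seen as a complex matrix. -/
def toC {m n : Type*} (A : Matrix m n ℝ) : Matrix m n ℂ := A.map Complex.ofReal

/-- `U_s J̃_s(ω) U_s^*`. -/
def sourceDensity (Us : Matrix (Fin 3) (Fin 2) ℝ) (J : ℝ → Matrix (Fin 2) (Fin 2) ℂ) (ω : ℝ) :
    Matrix (Fin 3) (Fin 3) ℂ :=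
  toC Us * J ω * (toC Us)ᴴ

/-- The time domain function `J̃_s(τ) = ∫ J̃_s(ω) exp(-i ω τ) dω` (entry by entry). -/
def timeDomain (J : ℝ → Matrix (Fin 2) (Fin 2) ℂ) (τ : ℝ) : Matrix (Fin 2) (Fin 2) ℂ :=
  Matrix.of fun i j => ∫ ω : ℝ, Complex.exp (-(Complex.I * ω * τ)) * J ω i j

/-- The coherency matrix data
`ψ(x, ω) = U_∥^* (G + Π) U_s J̃_s(ω) U_s^* (G + Π)^* U_∥`. -/
def coherency (S : Scene) (Us : Matrix (Fin 3) (Fin 2) ℝ) (J : ℝ → Matrix (Fin 2) (Fin 2) ℂ)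
    (x : Point) (ω : ℝ) : Matrix (Fin 2) (Fin 2) ℂ :=
  (toC Upar)ᴴ *
    (S.bornTransfer x ω * sourceDensity Us J ω * (S.bornTransfer x ω)ᴴ) * toC Upar

variable {Ω : Type*} [MeasurableSpace Ω]

/-- Admissible source spectra: a coherency matrix (Hermitian, positive semidefinite) at each
frequency, obeying `J̃_s(-ω) = conj (J̃_s(ω))`, of finite total power. -/
structure IsSourceSpectrum (J : ℝ → Matrix (Fin 2) (Fin 2) ℂ) : Prop where
  posSemidef : ∀ ω, (J ω).PosSemidef
  reflection : ∀ ω i j, J (-ω) i j = star (J ω i j)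
  integrable : ∀ i j, Integrable fun ω => J ω i j

/-- `j` is a real Gaussian process with mean zero and
`⟨j(t+τ) j(t)ᵀ⟩ = U_s J̃_s(τ) U_s^*`.  (A Gaussian process whose mean is constant and whose
covariance depends on the time lag only is stationary.) -/
structure IsGaussianSource (P : Measure Ω) (Us : Matrix (Fin 3) (Fin 2) ℝ)
    (J : ℝ → Matrix (Fin 2) (Fin 2) ℂ) (j : ℝ → Ω → (Fin 3 → ℝ)) : Prop where
  gaussian : IsGaussianProcess j P
  mean_zero : ∀ t m, ∫ w, j t w m ∂P = 0
  covariance : ∀ t τ m n,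
    ((∫ w, j (t + τ) w m * j t w n ∂P : ℝ) : ℂ) = (toC Us * timeDomain J τ * (toC Us)ᴴ) m n

/-- `X = ∫ f(ω) · j(ω) dω`, where `j(ω) dω` is the (random, white in `ω`) Fourier transform of the
stationary process `j(t) = ∫ exp(-i ω t) j(ω) dω` with spectral density matrix `S`.

Taking a trigonometric polynomial `p(ω) = ∑ₛ exp(-i ω s) aₛ`, with vector coefficients `aₛ`, to
`∑ₛ aₛ · j(s)` is an isometry from the norm `(∫ p S p^* dω)^(1/2)` to `L²(P)`; the integral of `f`
is the value at `f` of its extension to the closure, that is, the mean square limit of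
`∑ₛ aₛ · j(s)` along trigonometric polynomials that tend to `f`. -/
def IsSpectralIntegral (P : Measure Ω) (S : ℝ → Matrix (Fin 3) (Fin 3) ℂ)
    (j : ℝ → Ω → (Fin 3 → ℝ)) (f : ℝ → Fin 3 → ℂ) (X : Ω → ℂ) : Prop :=
  ∀ ε : ℝ≥0∞, 0 < ε → ∃ (F : Finset ℝ) (a : ℝ → Fin 3 → ℂ),
    (∫⁻ ω : ℝ, ENNReal.ofReal
      ((f ω - ∑ s ∈ F, Complex.exp (-(Complex.I * ω * s)) • a s) ⬝ᵥ
        (S ω *ᵥ star (f ω - ∑ s ∈ F, Complex.exp (-(Complex.I * ω * s)) • a s))).re) ≤ ε ∧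
    (∫⁻ w, ‖X w - ∑ s ∈ F, ∑ m, a s m * ((j s w m : ℝ) : ℂ)‖ₑ ^ 2 ∂P) ≤ ε

/-- `E` is (a jointly measurable version of) the real time domain total electric field at `x` in the
Born approximation: `E(x,t) = ∫ exp(-i ω t) E(x,ω) dω` with `E(x,ω) = (G + Π)(x,ω) j(ω)`. -/
structure IsBornField (P : Measure Ω) (S : Scene) (Us : Matrix (Fin 3) (Fin 2) ℝ)
    (J : ℝ → Matrix (Fin 2) (Fin 2) ℂ) (j : ℝ → Ω → (Fin 3 → ℝ)) (x : Point)
    (E : ℝ → Ω → (Fin 3 → ℝ)) : Prop where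
  measurable : Measurable (Function.uncurry E)
  spectral : ∀ (t : ℝ) (i : Fin 3), IsSpectralIntegral P (sourceDensity Us J) j
    (fun ω m => Complex.exp (-(Complex.I * (ω : ℂ) * ((t : ℝ) : ℂ))) * S.bornTransfer x ω i m)
    (fun w => ((E t w i : ℝ) : ℂ))

/-- `U_∥^* E(t+τ) E(t)ᵀ U_∥`. -/
def crossCorr (E : ℝ → Ω → (Fin 3 → ℝ)) (τ t : ℝ) (w : Ω) : Matrix (Fin 2) (Fin 2) ℝ :=
  Uparᵀ * Matrix.vecMulVec (E (t + τ) w) (E t w) * Upar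

/-- The empirical autocorrelation
`ψ_emp(τ) = (1 / 2T) ∫_{-T}^{T} U_∥^* E(t+τ) E(t)ᵀ U_∥ dt`. -/
def empAutocorr (E : ℝ → Ω → (Fin 3 → ℝ)) (T τ : ℝ) (w : Ω) : Matrix (Fin 2) (Fin 2) ℝ :=
  Matrix.of fun i j => (1 / (2 * T)) * ∫ t in (-T)..T, crossCorr E τ t w i j

end StatStab

end

open StatStab

/-!
The Born field is the output of a linear filter applied to a stationary Gaussian source, so its
empirical autocorrelations are time averages of products of two components of a stationary Gaussian
process. Three facts make them ergodic.

*Spectral isometry.* A pair `(f, X)` of a filter and its spectral integral is a limit of pairs of a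
trigonometric polynomial and a linear combination of the `j(s)`, and on such pairs the covariance
of the source says that the power in the frequency domain is the second moment. Both sides are
continuous along the limit (`HasSpectralDensity.isTrigLimit_isometry`), and polarization gives
`⟨E_i(t) E_k(s)⟩ = ∫ exp (-i ω (t - s)) (𝒢 D 𝒢^*)_{ik} dω` (`IsBornField.covariance`), which is the
formula for the mean of the empirical autocorrelation.

*Gaussianity.* The field lies in the closed real linear span of the source. Mean square limits of
centered Gaussian variables are centered Gaussian, so Isserlis' formula holds for the field
(`IsBornField.isserlis`), and with `C_ab(u) = ⟨E_a(t + u) E_b(t)⟩` the products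
`E_a(t + τ) E_b(t)` have covariance function
`R(u) = C_aa(u) C_bb(u) + C_ab(u + τ) C_ba(u - τ)`.

*Integrable memory.* The diagonal coherency data are square integrable and bound the off-diagonal
ones, so by Plancherel's theorem all `C_ab` are square integrable and `R` is integrable. The
variance of the average over `[-T, T]` is `(2T)⁻² ∬ R(t - s) dt ds ≤ (2T)⁻¹ ∫ |R|`
(`timeAverage_tendsto`).
-/

namespace StatStab

/-! ### Gaussian subspaces of `L²` and Isserlis' formula -/

section Gaussian

open scoped NNReal InnerProductSpace

variable {Ω : Type*} [MeasurableSpace Ω] {P : Measure Ω}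

lemma integral_pow_four_gaussianReal (v : ℝ≥0) :
    ∫ x, x ^ 4 ∂gaussianReal 0 v = 3 * (v : ℝ) ^ 2 := by
  have h0 : ∫ x, x ^ 4 ∂gaussianReal 0 v
      = iteratedDeriv 4 (mgf (fun x ↦ x) (gaussianReal 0 v)) 0 := by
    rw [iteratedDeriv_mgf_zero] <;> simp
  set e : ℝ → ℝ := fun t ↦ Real.exp (v * t ^ 2 / 2) with he
  have hd : ∀ t, HasDerivAt e (v * t * e t) t := fun t ↦ by
    have h : HasDerivAt (fun t : ℝ ↦ v * t ^ 2 / 2) (v * t) t := by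
      refine (((hasDerivAt_pow 2 t).const_mul (v : ℝ)).div_const 2).congr_deriv ?_
      simp; ring
    exact h.exp.congr_deriv (mul_comm _ _)
  -- each derivative of `exp (v t² / 2)` is a polynomial times `exp (v t² / 2)`
  have hp : ∀ (p p' : ℝ → ℝ), (∀ t, HasDerivAt p (p' t) t) →
      deriv (fun t ↦ p t * e t) = fun t ↦ (p' t + v * t * p t) * e t := by
    intro p p' h
    ext t
    exact (((h t).mul (hd t)).congr_deriv (by ring)).deriv
  have h1 : deriv e = fun t ↦ (v * t) * e t := by
    ext t; exact (hd t).deriv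
  have h2 : deriv (fun t ↦ (v * t) * e t) = fun t ↦ (v + v * t * (v * t)) * e t :=
    hp _ (fun _ ↦ v) fun t ↦ by simpa using (hasDerivAt_id t).const_mul (v : ℝ)
  have h3 : deriv (fun t ↦ (v + v * t * (v * t)) * e t)
      = fun t ↦ (2 * v ^ 2 * t + v * t * (v + v * t * (v * t))) * e t :=
    hp _ (fun t ↦ 2 * v ^ 2 * t) fun t ↦ by
      have := (((hasDerivAt_pow 2 t).const_mul ((v : ℝ) ^ 2)).const_add (v : ℝ)).congr_deriv
        (g' := 2 * v ^ 2 * t) (by simp; ring)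
      exact this.congr_of_eventuallyEq (.of_forall fun t ↦ by ring)
  have h4 : deriv (fun t ↦ (2 * v ^ 2 * t + v * t * (v + v * t * (v * t))) * e t)
      = fun t ↦ ((3 * v ^ 2 + 3 * v ^ 3 * t ^ 2)
        + v * t * (2 * v ^ 2 * t + v * t * (v + v * t * (v * t)))) * e t :=
    hp _ (fun t ↦ 3 * v ^ 2 + 3 * v ^ 3 * t ^ 2) fun t ↦ by
      have := (((hasDerivAt_id t).const_mul (3 * (v : ℝ) ^ 2)).add
        ((hasDerivAt_pow 3 t).const_mul ((v : ℝ) ^ 3))).congr_deriv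
        (g' := 3 * v ^ 2 + 3 * v ^ 3 * t ^ 2) (by simp; ring)
      exact this.congr_of_eventuallyEq (.of_forall fun t ↦ by simp; ring)
  rw [h0, mgf_fun_id_gaussianReal]
  simp only [zero_mul, zero_add, iteratedDeriv_succ, iteratedDeriv_zero]
  change deriv (deriv (deriv (deriv e))) 0 = _
  rw [h1, h2, h3, h4]
  simp [he]

/-- A subspace of `L²(P)` all of whose elements are centered Gaussian variables; the variance of an
element is then the square of its norm. -/
def IsCenteredGaussianSubspace (V : Submodule ℝ (Lp ℝ 2 P)) : Prop :=
  ∀ Z ∈ V, P.map Z = gaussianReal 0 (‖Z‖₊ ^ 2)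

lemma continuous_charFun_map_Lp [IsProbabilityMeasure P] (u : ℝ) :
    Continuous fun Z : Lp ℝ 2 P ↦ charFun (P.map Z) u := by
  have hint : ∀ Z : Lp ℝ 2 P, Integrable (fun w ↦ Complex.exp (u * Z w * Complex.I)) P := by
    intro Z
    refine Integrable.of_bound ?_ 1 (ae_of_all _ fun w ↦ ?_)
    · have := (Lp.aestronglyMeasurable Z).aemeasurable
      exact (by fun_prop : AEMeasurable _ P).aestronglyMeasurable
    · rw [← Complex.ofReal_mul, Complex.norm_exp_ofReal_mul_I]
  have heq : ∀ Z : Lp ℝ 2 P,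
      charFun (P.map Z) u = ∫ w, Complex.exp (u * Z w * Complex.I) ∂P := by
    intro Z
    rw [charFun_apply_real, integral_map (Lp.aestronglyMeasurable Z).aemeasurable (by fun_prop)]
  refine LipschitzWith.continuous (K := ‖u‖₊) (LipschitzWith.of_dist_le_mul fun Z W ↦ ?_)
  rw [dist_eq_norm, dist_eq_norm, heq, heq, ← integral_sub (hint Z) (hint W)]
  have hZW : MemLp (⇑(Z - W)) 2 P := Lp.memLp _
  have h1 : Integrable (⇑(Z - W)) P := hZW.integrable one_le_two
  calc ‖∫ w, (Complex.exp (u * Z w * Complex.I) - Complex.exp (u * W w * Complex.I)) ∂P‖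
      ≤ ∫ w, |u| * ‖(Z - W) w‖ ∂P := by
        refine norm_integral_le_of_norm_le (h1.norm.const_mul _) ?_
        filter_upwards [Lp.coeFn_sub Z W] with w hw
        rw [hw, Pi.sub_apply]
        have : Complex.exp (u * Z w * Complex.I) - Complex.exp (u * W w * Complex.I)
            = Complex.exp ((u * W w : ℝ) * Complex.I)
              * (Complex.exp (Complex.I * (u * (Z w - W w) : ℝ)) - 1) := by
          rw [mul_sub, ← Complex.exp_add, mul_one]
          push_cast
          congr 2
          all_goals ring
        rw [this, norm_mul, Complex.norm_exp_ofReal_mul_I, one_mul]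
        refine (Real.norm_exp_I_mul_ofReal_sub_one_le).trans ?_
        rw [norm_mul, Real.norm_eq_abs u]
    _ = |u| * ∫ w, ‖(Z - W) w‖ ∂P := integral_const_mul _ _
    _ ≤ |u| * ‖Z - W‖ := by
        gcongr
        rw [Lp.norm_def, integral_norm_eq_lintegral_enorm h1.1]
        refine ENNReal.toReal_mono (Lp.eLpNorm_ne_top _) ?_
        rw [← eLpNorm_one_eq_lintegral_enorm]
        exact eLpNorm_le_eLpNorm_of_exponent_le one_le_two h1.1
    _ = _ := by simp

/-- Characteristic functions are continuous in mean square, so that mean square limits of centered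
Gaussian variables are centered Gaussian. -/
lemma IsCenteredGaussianSubspace.topologicalClosure [IsProbabilityMeasure P]
    {V : Submodule ℝ (Lp ℝ 2 P)} (hV : IsCenteredGaussianSubspace V) :
    IsCenteredGaussianSubspace V.topologicalClosure := by
  intro Z hZ
  have hclosed : IsClosed {Z : Lp ℝ 2 P | ∀ u : ℝ, charFun (P.map Z) u
      = Complex.exp (-(((‖Z‖ ^ 2 : ℝ) : ℂ) * u ^ 2 / 2))} := by
    simp only [Set.ofPred_forall]
    exact isClosed_iInter fun u ↦ isClosed_eq (continuous_charFun_map_Lp u) (by fun_prop)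
  have hsub : (V : Set (Lp ℝ 2 P)) ⊆ {Z : Lp ℝ 2 P | ∀ u : ℝ, charFun (P.map Z) u
      = Complex.exp (-(((‖Z‖ ^ 2 : ℝ) : ℂ) * u ^ 2 / 2))} := by
    intro Y hY u
    rw [hV Y hY, charFun_gaussianReal]
    simp
  have hZ' := hclosed.closure_subset_iff.2 hsub hZ
  have : IsProbabilityMeasure (P.map Z) :=
    Measure.isProbabilityMeasure_map (Lp.aestronglyMeasurable Z).aemeasurable
  refine Measure.ext_of_charFun ?_
  ext u
  rw [hZ' u, charFun_gaussianReal]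
  simp

lemma IsCenteredGaussianSubspace.memLp_four {V : Submodule ℝ (Lp ℝ 2 P)}
    (hV : IsCenteredGaussianSubspace V) {Z : Lp ℝ 2 P} (hZ : Z ∈ V) : MemLp Z 4 P := by
  have h : MemLp id 4 (P.map Z) := by
    rw [hV Z hZ]
    exact memLp_id_gaussianReal' 4 (by simp)
  simpa using h.comp_of_map (Lp.aestronglyMeasurable Z).aemeasurable

lemma IsCenteredGaussianSubspace.integral_pow_four {V : Submodule ℝ (Lp ℝ 2 P)}
    (hV : IsCenteredGaussianSubspace V) {Z : Lp ℝ 2 P} (hZ : Z ∈ V) :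
    ∫ w, Z w ^ 4 ∂P = 3 * ⟪Z, Z⟫_ℝ ^ 2 := by
  have h := integral_map (μ := P) (Lp.aestronglyMeasurable Z).aemeasurable
    (f := fun x : ℝ ↦ x ^ 4) (by fun_prop)
  rw [← h, hV Z hZ, integral_pow_four_gaussianReal, real_inner_self_eq_norm_sq]
  simp

/-- Isserlis' formula for the fourth order mixed moments of a centered Gaussian subspace, obtained
from `integral_pow_four` by polarization. -/
lemma IsCenteredGaussianSubspace.integral_mul_mul_mul {V : Submodule ℝ (Lp ℝ 2 P)}
    (hV : IsCenteredGaussianSubspace V) {X Y Z W : Lp ℝ 2 P} (hX : X ∈ V) (hY : Y ∈ V)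
    (hZ : Z ∈ V) (hW : W ∈ V) :
    ∫ w, X w * Y w * (Z w * W w) ∂P
      = ⟪X, Y⟫_ℝ * ⟪Z, W⟫_ℝ + ⟪X, Z⟫_ℝ * ⟪Y, W⟫_ℝ + ⟪X, W⟫_ℝ * ⟪Y, Z⟫_ℝ := by
  have key : ∀ a b c : ℝ, Integrable (fun w ↦ (X w + a * Y w + b * Z w + c * W w) ^ 4) P ∧
      ∫ w, (X w + a * Y w + b * Z w + c * W w) ^ 4 ∂P
        = 3 * (⟪X, X⟫_ℝ + a ^ 2 * ⟪Y, Y⟫_ℝ + b ^ 2 * ⟪Z, Z⟫_ℝ + c ^ 2 * ⟪W, W⟫_ℝ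
          + 2 * (a * ⟪X, Y⟫_ℝ + b * ⟪X, Z⟫_ℝ + c * ⟪X, W⟫_ℝ + a * b * ⟪Y, Z⟫_ℝ
            + a * c * ⟪Y, W⟫_ℝ + b * c * ⟪Z, W⟫_ℝ)) ^ 2 := by
    intro a b c
    have hmem : X + a • Y + b • Z + c • W ∈ V :=
      V.add_mem (V.add_mem (V.add_mem hX (V.smul_mem a hY)) (V.smul_mem b hZ)) (V.smul_mem c hW)
    have hae : ⇑(X + a • Y + b • Z + c • W)
        =ᵐ[P] fun w ↦ X w + a * Y w + b * Z w + c * W w := by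
      filter_upwards [Lp.coeFn_add (X + a • Y + b • Z) (c • W), Lp.coeFn_add (X + a • Y) (b • Z),
        Lp.coeFn_add X (a • Y), Lp.coeFn_smul a Y, Lp.coeFn_smul b Z, Lp.coeFn_smul c W]
        with w h1 h2 h3 h4 h5 h6
      rw [h1, Pi.add_apply, h2, Pi.add_apply, h3, Pi.add_apply, h4, h5, h6]
      rfl
    have hae4 : (fun w ↦ (X + a • Y + b • Z + c • W) w ^ 4)
        =ᵐ[P] fun w ↦ (X w + a * Y w + b * Z w + c * W w) ^ 4 := by
      filter_upwards [hae] with w hw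
      rw [hw]
    constructor
    · refine Integrable.congr ?_ hae4
      have := (hV.memLp_four hmem).integrable_norm_pow (p := 4) (by norm_num)
      simpa [Real.norm_eq_abs, Even.pow_abs (⟨2, rfl⟩ : Even 4)] using this
    · rw [← integral_congr_ae hae4, hV.integral_pow_four hmem]
      simp only [inner_add_left, inner_add_right, real_inner_smul_left, real_inner_smul_right]
      rw [real_inner_comm X Y, real_inner_comm X Z, real_inner_comm X W, real_inner_comm Y Z,
        real_inner_comm Y W, real_inner_comm Z W]
      ring
  -- the polarization identity for the fourth power, with the sign of `X` normalized
  have hpt : ∀ w, X w * Y w * (Z w * W w) = (1 / 192) *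
      ((X w + 1 * Y w + 1 * Z w + 1 * W w) ^ 4 - (X w + (-1) * Y w + 1 * Z w + 1 * W w) ^ 4
      - (X w + 1 * Y w + (-1) * Z w + 1 * W w) ^ 4 - (X w + 1 * Y w + 1 * Z w + (-1) * W w) ^ 4
      + (X w + (-1) * Y w + (-1) * Z w + 1 * W w) ^ 4
      + (X w + (-1) * Y w + 1 * Z w + (-1) * W w) ^ 4
      + (X w + 1 * Y w + (-1) * Z w + (-1) * W w) ^ 4
      - (X w + (-1) * Y w + (-1) * Z w + (-1) * W w) ^ 4) := fun w ↦ by ring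
  simp_rw [hpt]
  have i1 := (key 1 1 1).1
  have i2 := (key (-1) 1 1).1
  have i3 := (key 1 (-1) 1).1
  have i4 := (key 1 1 (-1)).1
  have i5 := (key (-1) (-1) 1).1
  have i6 := (key (-1) 1 (-1)).1
  have i7 := (key 1 (-1) (-1)).1
  have i8 := (key (-1) (-1) (-1)).1
  rw [integral_const_mul, integral_sub (by fun_prop) i8, integral_add (by fun_prop) i7,
    integral_add (by fun_prop) i6, integral_add (by fun_prop) i5, integral_sub (by fun_prop) i4,
    integral_sub (by fun_prop) i3, integral_sub i1 i2]
  simp only [(key _ _ _).2]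
  ring

end Gaussian

/-! ### Plancherel's theorem -/

section Plancherel

open FourierTransform SchwartzMap

/-- Plancherel's theorem for an integrable and square integrable function, qualitatively: its
Fourier integral represents its `L²` Fourier transform, since both define the same tempered
distribution. -/
lemma memLp_two_fourier {f : ℝ → ℂ} (h1 : Integrable f) (h2 : MemLp f 2 volume) :
    MemLp (𝓕 f) 2 volume := by
  set F : Lp (α := ℝ) ℂ 2 volume := h2.toLp f with hF
  have hcont : Continuous (𝓕 f) :=
    VectorFourier.fourierIntegral_continuous (μ := volume) (L := innerₗ ℝ) Real.continuous_fourierChar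
      (by exact continuous_inner) h1
  have hloc : LocallyIntegrable (⇑(𝓕 F : Lp (α := ℝ) ℂ 2 volume)) volume :=
    (Lp.memLp (𝓕 F)).locallyIntegrable one_le_two
  have hae : ∀ᵐ x ∂(volume : Measure ℝ), (𝓕 F : Lp (α := ℝ) ℂ 2 volume) x = 𝓕 f x := by
    refine ae_eq_of_integral_contDiff_smul_eq hloc hcont.locallyIntegrable fun g hg hgs ↦ ?_
    have hgs' : HasCompactSupport fun x ↦ (g x : ℂ) := hgs.comp_left (g := Complex.ofReal) rfl
    have hg' : ContDiff ℝ (⊤ : ℕ∞) fun x ↦ (g x : ℂ) := Complex.ofRealCLM.contDiff.comp hg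
    set φ : 𝓢(ℝ, ℂ) := hgs'.toSchwartzMap hg' with hφ
    have hφx : ∀ x, φ x = (g x : ℂ) := fun x ↦ rfl
    have e1 := congrArg (fun T : 𝓢'(ℝ, ℂ) ↦ T φ) (Lp.fourier_toTemperedDistribution_eq F)
    simp only [TemperedDistribution.fourier_apply, Lp.toTemperedDistribution_apply] at e1
    have e2 : ∫ x, (𝓕 φ) x • F x = ∫ x, (𝓕 (φ : ℝ → ℂ)) x • f x := by
      refine integral_congr_ae ?_
      filter_upwards [h2.coeFn_toLp] with x hx
      rw [hF, hx, SchwartzMap.fourier_coe]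
    have e3 : ∫ x, (𝓕 (φ : ℝ → ℂ)) x • f x = ∫ x, φ x • 𝓕 f x := by
      simpa using! VectorFourier.integral_fourierIntegral_smul_eq_flip (L := innerₗ ℝ)
        (μ := volume) (ν := volume) Real.continuous_fourierChar continuous_inner φ.integrable h1
    rw [e2, e3] at e1
    simpa [hφx] using e1.symm
  exact (memLp_congr_ae hae).1 (Lp.memLp (𝓕 F))

/-- `memLp_two_fourier` for the kernel `exp (-i ω u)` instead of `exp (-2 π i ω u)`. -/
lemma memLp_two_integral_exp_mul {f : ℝ → ℂ} (h1 : Integrable f) (h2 : MemLp f 2 volume) :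
    MemLp (fun u : ℝ ↦ ∫ ω : ℝ, Complex.exp (-(Complex.I * ω * u)) * f ω) 2 volume := by
  have h := memLp_two_fourier h1 h2
  have heq : (fun u : ℝ ↦ ∫ ω : ℝ, Complex.exp (-(Complex.I * ω * u)) * f ω)
      = fun u ↦ 𝓕 f ((2 * Real.pi)⁻¹ * u) := by
    ext u
    rw [Real.fourier_real_eq_integral_exp_smul]
    refine integral_congr_ae (ae_of_all _ fun ω ↦ ?_)
    simp only [smul_eq_mul]
    congr 2
    push_cast
    have : (Real.pi : ℂ) ≠ 0 := by exact_mod_cast Real.pi_ne_zero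
    field_simp
  rw [heq]
  have hc : (2 * Real.pi)⁻¹ ≠ 0 := by positivity
  refine MemLp.comp_of_map (f := fun u : ℝ ↦ (2 * Real.pi)⁻¹ * u) (g := 𝓕 f) ?_ (by fun_prop)
  rw [Real.map_volume_mul_left hc]
  exact h.smul_measure ENNReal.ofReal_ne_top

end Plancherel

/-! ### Time averages of stationary processes -/

section TimeAverage

variable {Ω α : Type*} [MeasurableSpace Ω] [MeasurableSpace α]

lemma lintegral_enorm_sq_eq {E : Type*} [NormedAddCommGroup E] {μ : Measure α} (f : α → E) :
    ∫⁻ x, ‖f x‖ₑ ^ 2 ∂μ = eLpNorm f 2 μ ^ 2 := by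
  rw [eLpNorm_eq_lintegral_rpow_enorm_toReal (by norm_num) (by norm_num), ← ENNReal.rpow_natCast,
    ← ENNReal.rpow_mul]
  simp

lemma memLp_two_iff_lintegral_lt_top {E : Type*} [NormedAddCommGroup E] {μ : Measure α}
    {f : α → E} (hf : AEStronglyMeasurable f μ) :
    MemLp f 2 μ ↔ ∫⁻ x, ‖f x‖ₑ ^ 2 ∂μ < ∞ := by
  rw [lintegral_enorm_sq_eq, ENNReal.pow_lt_top_iff]
  simp [MemLp, hf]

lemma sq_lintegral_le {μ : Measure α} {f : α → ℝ≥0∞} (hf : AEMeasurable f μ) :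
    (∫⁻ x, f x ∂μ) ^ 2 ≤ μ Set.univ * ∫⁻ x, f x ^ 2 ∂μ := by
  have h := ENNReal.lintegral_mul_le_Lp_mul_Lq μ (p := 2) (q := 2)
    (Real.holderConjugate_iff.2 (by norm_num)) hf (aemeasurable_const (b := (1 : ℝ≥0∞)))
  simp only [Pi.mul_apply, mul_one, ENNReal.one_rpow, lintegral_const, one_mul] at h
  calc (∫⁻ x, f x ∂μ) ^ 2
      ≤ ((∫⁻ x, f x ^ (2 : ℝ) ∂μ) ^ (1 / 2 : ℝ) * μ Set.univ ^ (1 / 2 : ℝ)) ^ 2 := by gcongr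
    _ = μ Set.univ * ∫⁻ x, f x ^ 2 ∂μ := by
        rw [mul_pow, ← ENNReal.rpow_natCast, ← ENNReal.rpow_natCast, ← ENNReal.rpow_mul,
          ← ENNReal.rpow_mul, mul_comm]
        simp

section FiniteMeasure

variable {P : Measure Ω} [IsProbabilityMeasure P] {μ : Measure α} [IsFiniteMeasure μ]
  {X : α → Ω → ℝ} {K : ℝ≥0∞}

lemma memLp_two_uncurry (hX : Measurable (Function.uncurry X)) (hK : K ≠ ∞)
    (h2 : ∀ t, ∫⁻ w, ‖X t w‖ₑ ^ 2 ∂P ≤ K) : MemLp (Function.uncurry X) 2 (μ.prod P) := by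
  rw [memLp_two_iff_lintegral_lt_top hX.aestronglyMeasurable,
    lintegral_prod _ (by fun_prop)]
  calc ∫⁻ t, ∫⁻ w, ‖X t w‖ₑ ^ 2 ∂P ∂μ ≤ ∫⁻ _, K ∂μ := lintegral_mono h2
    _ = K * μ Set.univ := lintegral_const _
    _ < ∞ := ENNReal.mul_lt_top hK.lt_top (measure_lt_top _ _)

lemma memLp_two_integral (hX : Measurable (Function.uncurry X)) (hK : K ≠ ∞)
    (h2 : ∀ t, ∫⁻ w, ‖X t w‖ₑ ^ 2 ∂P ≤ K) : MemLp (fun w ↦ ∫ t, X t w ∂μ) 2 P := by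
  have hm : StronglyMeasurable fun w ↦ ∫ t, X t w ∂μ :=
    StronglyMeasurable.integral_prod_left hX.stronglyMeasurable
  have hu := (memLp_two_iff_lintegral_lt_top hX.aestronglyMeasurable).1
    (memLp_two_uncurry (μ := μ) hX hK h2)
  rw [memLp_two_iff_lintegral_lt_top hm.aestronglyMeasurable]
  calc ∫⁻ w, ‖∫ t, X t w ∂μ‖ₑ ^ 2 ∂P
      ≤ ∫⁻ w, (∫⁻ t, ‖X t w‖ₑ ∂μ) ^ 2 ∂P := by
        gcongr
        exact enorm_integral_le_lintegral_enorm _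
    _ ≤ ∫⁻ w, μ Set.univ * ∫⁻ t, ‖X t w‖ₑ ^ 2 ∂μ ∂P := by
        gcongr with w
        exact sq_lintegral_le (by fun_prop)
    _ = μ Set.univ * ∫⁻ w, ∫⁻ t, ‖X t w‖ₑ ^ 2 ∂μ ∂P :=
        lintegral_const_mul' _ _ (measure_ne_top _ _)
    _ = μ Set.univ * ∫⁻ p, ‖Function.uncurry X p‖ₑ ^ 2 ∂(μ.prod P) := by
        rw [lintegral_prod_symm _ (by fun_prop)]
        rfl
    _ < ∞ := ENNReal.mul_lt_top (measure_lt_top _ _) hu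

lemma ae_integrable_of_lintegral_sq_le (hX : Measurable (Function.uncurry X)) (hK : K ≠ ∞)
    (h2 : ∀ t, ∫⁻ w, ‖X t w‖ₑ ^ 2 ∂P ≤ K) : ∀ᵐ w ∂P, Integrable (fun t ↦ X t w) μ :=
  ((memLp_two_uncurry (μ := μ) hX hK h2).integrable one_le_two).prod_left_ae

lemma integral_integral_eq_of_lintegral_sq_le (hX : Measurable (Function.uncurry X)) (hK : K ≠ ∞)
    (h2 : ∀ t, ∫⁻ w, ‖X t w‖ₑ ^ 2 ∂P ≤ K) :
    ∫ w, ∫ t, X t w ∂μ ∂P = ∫ t, ∫ w, X t w ∂P ∂μ :=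
  (integral_integral_swap ((memLp_two_uncurry (μ := μ) hX hK h2).integrable one_le_two)).symm

/-- Correlating the process with its integral `Z` over `μ`: `⟨V Z⟩ = ∫ ⟨V X_t⟩ dμ(t)` for every
square integrable variable `V`, and for `V = X_t` this is integrable in `t` with integral `⟨Z²⟩`. -/
lemma integral_mul_integral_eq (hX : Measurable (Function.uncurry X)) (hK : K ≠ ∞)
    (h2 : ∀ t, ∫⁻ w, ‖X t w‖ₑ ^ 2 ∂P ≤ K) {V : Ω → ℝ} (hV : MemLp V 2 P) :
    Integrable (fun t ↦ ∫ w, V w * X t w ∂P) μ ∧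
      ∫ w, V w * ∫ t, X t w ∂μ ∂P = ∫ t, ∫ w, V w * X t w ∂P ∂μ := by
  have hint : Integrable (fun p : α × Ω ↦ V p.2 * X p.1 p.2) (μ.prod P) :=
    (hV.comp_snd μ).integrable_mul (memLp_two_uncurry (μ := μ) hX hK h2)
  refine ⟨hint.integral_prod_left, ?_⟩
  rw [← integral_integral_swap (f := fun w t ↦ V w * X t w)]
  · simp_rw [integral_const_mul]
  · exact hint.swap

end FiniteMeasure

variable {P : Measure Ω} [IsProbabilityMeasure P] {X : ℝ → Ω → ℝ} {R : ℝ → ℝ} {m : ℝ}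

/-- The variance of the integral of a process with stationary, integrable covariance `R` grows at
most linearly with the length of the interval. -/
lemma variance_intervalIntegral_le (hX : Measurable (Function.uncurry X))
    (hm : ∀ t, ∫ w, X t w ∂P = m) (hL : ∀ t, MemLp (X t) 2 P)
    (hc : ∀ t s, ∫ w, X t w * X s w ∂P = m ^ 2 + R (t - s)) (hR : Integrable R) {T : ℝ}
    (hT : 0 < T) :
    (∀ᵐ w ∂P, IntervalIntegrable (fun t ↦ X t w) volume (-T) T) ∧
      MemLp (fun w ↦ ∫ t in (-T)..T, X t w) 2 P ∧
      ∫ w, (∫ t in (-T)..T, X t w) ∂P = 2 * T * m ∧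
      Var[fun w ↦ ∫ t in (-T)..T, X t w; P] ≤ 2 * T * ∫ u, |R u| := by
  have hle : -T ≤ T := by linarith
  simp only [intervalIntegrable_iff_integrableOn_Ioc_of_le hle,
    intervalIntegral.integral_of_le hle, IntegrableOn]
  set μ : Measure ℝ := volume.restrict (Set.Ioc (-T) T) with hμ
  have hμu : μ.real Set.univ = 2 * T := by
    simp [hμ, measureReal_def, ENNReal.toReal_ofReal (by linarith : (0 : ℝ) ≤ T + T)]
    ring
  have h2 : ∀ t, ∫⁻ w, ‖X t w‖ₑ ^ 2 ∂P ≤ ENNReal.ofReal (m ^ 2 + R 0) := by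
    intro t
    have h : ∫ w, X t w ^ 2 ∂P = m ^ 2 + R 0 := by simpa [sq] using hc t t
    rw [← h, ofReal_integral_eq_lintegral_ofReal (hL t).integrable_sq
      (ae_of_all _ fun _ ↦ sq_nonneg _)]
    refine lintegral_mono fun w ↦ le_of_eq ?_
    rw [← sq_abs, ENNReal.ofReal_pow (abs_nonneg _), Real.enorm_eq_ofReal_abs]
  have hK := ENNReal.ofReal_ne_top (r := m ^ 2 + R 0)
  have hZ : MemLp (fun w ↦ ∫ t, X t w ∂μ) 2 P := memLp_two_integral hX hK h2
  have hmean : ∫ w, ∫ t, X t w ∂μ ∂P = 2 * T * m := by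
    rw [integral_integral_eq_of_lintegral_sq_le hX hK h2]
    simp [hm, hμu]
  refine ⟨ae_integrable_of_lintegral_sq_le hX hK h2, hZ, hmean, ?_⟩
  have hsq : ∫ w, (∫ t, X t w ∂μ) ^ 2 ∂P = ∫ t, ∫ w, (∫ s, X s w ∂μ) * X t w ∂P ∂μ := by
    rw [← (integral_mul_integral_eq hX hK h2 hZ).2]
    simp_rw [sq]
  have hcov : ∀ t, ∫ w, (∫ s, X s w ∂μ) * X t w ∂P = 2 * T * m ^ 2 + ∫ s, R (t - s) ∂μ := by
    intro t
    have h := (integral_mul_integral_eq (μ := μ) hX hK h2 (hL t)).2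
    simp_rw [mul_comm (∫ s, X s _ ∂μ), h, hc]
    rw [integral_add (integrable_const _) (hR.comp_sub_left t).restrict]
    rw [integral_const, hμu, smul_eq_mul]
  have hint := (integral_mul_integral_eq (μ := μ) hX hK h2 hZ).1
  rw [variance_eq_sub hZ]
  simp only [Pi.pow_apply]
  rw [hmean, hsq]
  have hsplit : ∫ t, ∫ w, (∫ s, X s w ∂μ) * X t w ∂P ∂μ - (2 * T * m) ^ 2
      = ∫ t, ∫ s, R (t - s) ∂μ ∂μ := by
    have h : ∫ t, ((∫ w, (∫ s, X s w ∂μ) * X t w ∂P) - 2 * T * m ^ 2) ∂μ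
        = ∫ t, ∫ s, R (t - s) ∂μ ∂μ := by
      simp_rw [hcov, add_sub_cancel_left]
    rw [← h, integral_sub hint (integrable_const _)]
    simp [hμu]
    ring
  rw [hsplit]
  refine (le_abs_self _).trans ?_
  have hb : ∀ t, ‖∫ s, R (t - s) ∂μ‖ ≤ ∫ u, |R u| := by
    intro t
    refine (norm_integral_le_integral_norm _).trans ?_
    calc ∫ s, ‖R (t - s)‖ ∂μ ≤ ∫ s, ‖R (t - s)‖ :=
          setIntegral_le_integral (hR.comp_sub_left t).norm (ae_of_all _ fun _ ↦ norm_nonneg _)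
      _ = ∫ u, |R u| := integral_sub_left_eq_self (fun u ↦ ‖R u‖) volume t
  have := norm_integral_le_of_norm_le_const (μ := μ) (ae_of_all _ hb)
  rwa [hμu, mul_comm, Real.norm_eq_abs] at this

/-- Ergodicity in mean square of a second order process with integrable stationary covariance. -/
lemma timeAverage_tendsto (hX : Measurable (Function.uncurry X))
    (hm : ∀ t, ∫ w, X t w ∂P = m) (hL : ∀ t, MemLp (X t) 2 P)
    (hc : ∀ t s, ∫ w, X t w * X s w ∂P = m ^ 2 + R (t - s)) (hR : Integrable R) :
    (∀ T : ℝ, 0 < T →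
      (∀ᵐ w ∂P, IntervalIntegrable (fun t ↦ X t w) volume (-T) T) ∧
      MemLp (fun w ↦ (1 / (2 * T)) * ∫ t in (-T)..T, X t w) 2 P ∧
      ∫ w, (1 / (2 * T)) * (∫ t in (-T)..T, X t w) ∂P = m) ∧
    (fun T : ℝ ↦ Var[fun w ↦ (1 / (2 * T)) * ∫ t in (-T)..T, X t w; P])
      =O[atTop] (fun T : ℝ ↦ 1 / T) ∧
    Tendsto (fun T : ℝ ↦ eLpNorm (fun w ↦ (1 / (2 * T)) * (∫ t in (-T)..T, X t w) - m) 2 P)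
      atTop (𝓝 0) := by
  have hmean : ∀ T : ℝ, 0 < T →
      (∀ᵐ w ∂P, IntervalIntegrable (fun t ↦ X t w) volume (-T) T) ∧
      MemLp (fun w ↦ (1 / (2 * T)) * ∫ t in (-T)..T, X t w) 2 P ∧
      ∫ w, (1 / (2 * T)) * (∫ t in (-T)..T, X t w) ∂P = m := by
    intro T hT
    obtain ⟨h1, h2, h3, -⟩ := variance_intervalIntegral_le hX hm hL hc hR hT
    refine ⟨h1, h2.const_mul _, ?_⟩
    rw [integral_const_mul, h3]
    field_simp
  have hvar : ∀ T : ℝ, 0 < T → Var[fun w ↦ (1 / (2 * T)) * ∫ t in (-T)..T, X t w; P]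
      ≤ ((∫ u, |R u|) / 2) * (1 / T) := by
    intro T hT
    obtain ⟨-, -, -, h4⟩ := variance_intervalIntegral_le hX hm hL hc hR hT
    rw [variance_const_mul]
    calc (1 / (2 * T)) ^ 2 * Var[fun w ↦ ∫ t in (-T)..T, X t w; P]
        ≤ (1 / (2 * T)) ^ 2 * (2 * T * ∫ u, |R u|) := by gcongr
      _ = _ := by field_simp
  refine ⟨hmean, ?_, ?_⟩
  · refine Asymptotics.IsBigO.of_bound ((∫ u, |R u|) / 2) ?_
    filter_upwards [eventually_gt_atTop 0] with T hT
    rw [Real.norm_of_nonneg (variance_nonneg _ _), Real.norm_of_nonneg (by positivity)]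
    exact hvar T hT
  · have hsq : Tendsto (fun T : ℝ ↦
        eLpNorm (fun w ↦ (1 / (2 * T)) * (∫ t in (-T)..T, X t w) - m) 2 P ^ 2) atTop (𝓝 0) := by
      have hlim : Tendsto (fun T : ℝ ↦ ENNReal.ofReal (((∫ u, |R u|) / 2) * (1 / T)))
          atTop (𝓝 0) := by
        have : Tendsto (fun T : ℝ ↦ ((∫ u, |R u|) / 2) * (1 / T)) atTop (𝓝 0) := by
          simpa using (tendsto_inv_atTop_zero (𝕜 := ℝ)).const_mul ((∫ u, |R u|) / 2)
        simpa using ENNReal.tendsto_ofReal this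
      refine tendsto_of_tendsto_of_tendsto_of_le_of_le' tendsto_const_nhds hlim
        (Eventually.of_forall fun _ ↦ zero_le) ?_
      filter_upwards [eventually_gt_atTop 0] with T hT
      obtain ⟨-, h2, h3⟩ := hmean T hT
      rw [← lintegral_enorm_sq_eq]
      refine le_trans (le_of_eq ?_) (ENNReal.ofReal_le_ofReal (hvar T hT))
      rw [h2.ofReal_variance_eq, evariance, h3]
    have h := hsq.ennrpow_const (1 / 2)
    rw [ENNReal.zero_rpow_of_pos (by norm_num)] at h
    refine h.congr fun T ↦ ?_
    rw [← ENNReal.rpow_natCast, ← ENNReal.rpow_mul]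
    norm_num

end TimeAverage

/-! ### Mean square limits of trigonometric polynomials -/

section SpectralIsometry

open scoped NNReal

variable {Ω : Type*} [MeasurableSpace Ω] {P : Measure Ω}

/-- The cross spectral density `f D g^*` of two filters `f`, `g` applied to a stationary signal with
spectral density matrix `D`. -/
def crossPower (D : ℝ → Matrix (Fin 3) (Fin 3) ℂ) (f g : ℝ → Fin 3 → ℂ) (ω : ℝ) : ℂ :=
  f ω ⬝ᵥ (D ω *ᵥ star (g ω))

variable {D : ℝ → Matrix (Fin 3) (Fin 3) ℂ} {j : ℝ → Ω → (Fin 3 → ℝ)}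

lemma crossPower_add_left (f₁ f₂ g : ℝ → Fin 3 → ℂ) (ω : ℝ) :
    crossPower D (f₁ + f₂) g ω = crossPower D f₁ g ω + crossPower D f₂ g ω := by
  simp [crossPower, add_dotProduct]

lemma crossPower_add_right (f g₁ g₂ : ℝ → Fin 3 → ℂ) (ω : ℝ) :
    crossPower D f (g₁ + g₂) ω = crossPower D f g₁ ω + crossPower D f g₂ ω := by
  simp [crossPower, Matrix.mulVec_add, dotProduct_add]

lemma crossPower_smul_left (c : ℂ) (f g : ℝ → Fin 3 → ℂ) (ω : ℝ) :
    crossPower D (c • f) g ω = c * crossPower D f g ω := by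
  simp [crossPower]

lemma crossPower_smul_right (c : ℂ) (f g : ℝ → Fin 3 → ℂ) (ω : ℝ) :
    crossPower D f (c • g) ω = star c * crossPower D f g ω := by
  simp [crossPower, Matrix.mulVec_smul]

lemma crossPower_self_nonneg (hD : ∀ ω, (D ω).PosSemidef) (f : ℝ → Fin 3 → ℂ) (ω : ℝ) :
    0 ≤ crossPower D f f ω := by
  simpa [crossPower] using (hD ω).dotProduct_mulVec_nonneg (star (f ω))

lemma crossPower_self_add_smul (f g : ℝ → Fin 3 → ℂ) (c : ℂ) (ω : ℝ) :
    crossPower D (f + c • g) (f + c • g) ω = crossPower D f f ω + star c * crossPower D f g ω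
      + c * crossPower D g f ω + c * star c * crossPower D g g ω := by
  simp only [crossPower_add_left, crossPower_add_right, crossPower_smul_left,
    crossPower_smul_right]
  ring

lemma crossPower_self_add_le (hD : ∀ ω, (D ω).PosSemidef) (f g : ℝ → Fin 3 → ℂ) {δ : ℝ}
    (hδ : 0 < δ) (ω : ℝ) :
    (crossPower D (f + g) (f + g) ω).re
      ≤ (1 + δ) * (crossPower D f f ω).re + (1 + δ⁻¹) * (crossPower D g g ω).re := by
  have h1 := crossPower_self_add_smul (D := D) f g 1 ω
  -- positivity of the form at `f - δ⁻¹ g` bounds the cross terms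
  have h2 := crossPower_self_add_smul (D := D) f g (-(δ⁻¹ : ℝ) : ℂ) ω
  have h3 := (Complex.le_def.1 (crossPower_self_nonneg hD (f + (-(δ⁻¹ : ℝ) : ℂ) • g) ω)).1
  rw [h2] at h3
  rw [one_smul] at h1
  rw [h1]
  simp at h3 ⊢
  have h4 := mul_nonneg hδ.le h3
  have h5 : δ * δ⁻¹ = 1 := mul_inv_cancel₀ hδ.ne'
  have h6 : δ * ((crossPower D f f ω).re + -(δ⁻¹ * (crossPower D f g ω).re)
      + -(δ⁻¹ * (crossPower D g f ω).re) + δ⁻¹ * δ⁻¹ * (crossPower D g g ω).re)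
      = δ * (crossPower D f f ω).re - δ * δ⁻¹ * (crossPower D f g ω).re
      - δ * δ⁻¹ * (crossPower D g f ω).re + δ * δ⁻¹ * δ⁻¹ * (crossPower D g g ω).re := by ring
  rw [h6, h5] at h4
  linarith

lemma aemeasurable_crossPower (hDm : ∀ m n, AEMeasurable fun ω ↦ D ω m n) {f g : ℝ → Fin 3 → ℂ}
    (hf : ∀ m, AEMeasurable fun ω ↦ f ω m) (hg : ∀ m, AEMeasurable fun ω ↦ g ω m) :
    AEMeasurable (crossPower D f g) := by
  unfold crossPower
  simp only [dotProduct, Matrix.mulVec, Pi.star_apply]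
  fun_prop

/-- The power `∫ f D f^* dω`, possibly infinite, of the signal filtered by `f`. -/
noncomputable def filterPower (D : ℝ → Matrix (Fin 3) (Fin 3) ℂ) (f : ℝ → Fin 3 → ℂ) : ℝ≥0∞ :=
  ∫⁻ ω, ENNReal.ofReal (crossPower D f f ω).re

lemma filterPower_add_le (hD : ∀ ω, (D ω).PosSemidef) (hDm : ∀ m n, AEMeasurable fun ω ↦ D ω m n)
    {f g : ℝ → Fin 3 → ℂ} (hf : ∀ m, AEMeasurable fun ω ↦ f ω m) {δ : ℝ} (hδ : 0 < δ) :
    filterPower D (f + g)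
      ≤ ENNReal.ofReal (1 + δ) * filterPower D f
        + ENNReal.ofReal (1 + δ⁻¹) * filterPower D g := by
  have hm := aemeasurable_crossPower hDm hf hf
  unfold filterPower
  rw [← lintegral_const_mul' _ _ ENNReal.ofReal_ne_top,
    ← lintegral_const_mul' _ _ ENNReal.ofReal_ne_top, ← lintegral_add_left' (by fun_prop)]
  refine lintegral_mono fun ω ↦ ?_
  have h1 := (Complex.le_def.1 (crossPower_self_nonneg hD f ω)).1
  have h2 := (Complex.le_def.1 (crossPower_self_nonneg hD g ω)).1
  simp only [Complex.zero_re] at h1 h2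
  rw [← ENNReal.ofReal_mul (by positivity), ← ENNReal.ofReal_mul (by positivity),
    ← ENNReal.ofReal_add (by positivity) (by positivity)]
  exact ENNReal.ofReal_le_ofReal (crossPower_self_add_le hD f g hδ ω)

lemma filterPower_smul (c : ℂ) (f : ℝ → Fin 3 → ℂ) :
    filterPower D (c • f) = ENNReal.ofReal (‖c‖ ^ 2) * filterPower D f := by
  unfold filterPower
  rw [← lintegral_const_mul' _ _ ENNReal.ofReal_ne_top]
  refine lintegral_congr fun ω ↦ ?_
  rw [← ENNReal.ofReal_mul (by positivity), crossPower_smul_left, crossPower_smul_right,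
    ← mul_assoc]
  simp only [Complex.star_def, Complex.mul_conj, Complex.normSq_eq_norm_sq, Complex.re_ofReal_mul]

lemma norm_add_sq_le {a b : ℂ} {δ : ℝ} (hδ : 0 < δ) :
    ‖a + b‖ ^ 2 ≤ (1 + δ) * ‖a‖ ^ 2 + (1 + δ⁻¹) * ‖b‖ ^ 2 := by
  have h1 : ‖a + b‖ ^ 2 ≤ (‖a‖ + ‖b‖) ^ 2 := by
    gcongr
    exact norm_add_le _ _
  have h2 : 0 ≤ δ * (‖a‖ - δ⁻¹ * ‖b‖) ^ 2 := by positivity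
  have h3 : δ * (‖a‖ - δ⁻¹ * ‖b‖) ^ 2 = δ * ‖a‖ ^ 2 - 2 * ‖a‖ * ‖b‖ + δ⁻¹ * ‖b‖ ^ 2 := by
    field_simp
    ring
  nlinarith

lemma lintegral_enorm_add_sq_le {X Y : Ω → ℂ} (hX : AEMeasurable X P) {δ : ℝ} (hδ : 0 < δ) :
    ∫⁻ w, ‖(X + Y) w‖ₑ ^ 2 ∂P
      ≤ ENNReal.ofReal (1 + δ) * ∫⁻ w, ‖X w‖ₑ ^ 2 ∂P
        + ENNReal.ofReal (1 + δ⁻¹) * ∫⁻ w, ‖Y w‖ₑ ^ 2 ∂P := by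
  rw [← lintegral_const_mul' _ _ ENNReal.ofReal_ne_top,
    ← lintegral_const_mul' _ _ ENNReal.ofReal_ne_top, ← lintegral_add_left' (by fun_prop)]
  refine lintegral_mono fun w ↦ ?_
  simp only [← ofReal_norm]
  rw [← ENNReal.ofReal_pow (norm_nonneg _), ← ENNReal.ofReal_pow (norm_nonneg _),
    ← ENNReal.ofReal_pow (norm_nonneg _), ← ENNReal.ofReal_mul (by positivity),
    ← ENNReal.ofReal_mul (by positivity), ← ENNReal.ofReal_add (by positivity) (by positivity)]
  exact ENNReal.ofReal_le_ofReal (norm_add_sq_le hδ)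

/-- Comparison of two powers `A`, `B` through an approximant of power `C` at squared distance `δ²`.
The weighted triangle inequalities `filterPower_add_le` and `lintegral_enorm_add_sq_le` have this
form, and with it limits can be taken before the power of the limit is known to be finite. -/
lemma ennreal_le_of_forall_approx {A B : ℝ≥0∞}
    (h : ∀ δ : ℝ, 0 < δ → ∃ C : ℝ≥0∞,
      A ≤ ENNReal.ofReal (1 + δ) * C + ENNReal.ofReal (1 + δ⁻¹) * ENNReal.ofReal (δ ^ 2) ∧
      C ≤ ENNReal.ofReal (1 + δ) * B + ENNReal.ofReal (1 + δ⁻¹) * ENNReal.ofReal (δ ^ 2)) :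
    A ≤ B := by
  have hle : ∀ δ : ℝ, 0 < δ → A ≤ ENNReal.ofReal (1 + δ) * (ENNReal.ofReal (1 + δ) * B
      + ENNReal.ofReal (δ ^ 2 + δ)) + ENNReal.ofReal (δ ^ 2 + δ) := by
    intro δ hδ
    obtain ⟨C, h1, h2⟩ := h δ hδ
    have e : ENNReal.ofReal (1 + δ⁻¹) * ENNReal.ofReal (δ ^ 2) = ENNReal.ofReal (δ ^ 2 + δ) := by
      rw [← ENNReal.ofReal_mul (by positivity)]
      congr 1
      field_simp
    rw [e] at h1 h2
    exact h1.trans (by gcongr)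
  have hlim : Tendsto (fun δ : ℝ ↦ ENNReal.ofReal (1 + δ) * (ENNReal.ofReal (1 + δ) * B
      + ENNReal.ofReal (δ ^ 2 + δ)) + ENNReal.ofReal (δ ^ 2 + δ)) (𝓝[>] 0) (𝓝 B) := by
    have t1 : Tendsto (fun δ : ℝ ↦ ENNReal.ofReal (1 + δ)) (𝓝[>] 0) (𝓝 1) := by
      have : ContinuousAt (fun δ : ℝ ↦ ENNReal.ofReal (1 + δ)) 0 :=
        ENNReal.continuous_ofReal.continuousAt.comp (by fun_prop)
      simpa [ContinuousAt] using this.tendsto.mono_left nhdsWithin_le_nhds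
    have t2 : Tendsto (fun δ : ℝ ↦ ENNReal.ofReal (δ ^ 2 + δ)) (𝓝[>] 0) (𝓝 0) := by
      have : ContinuousAt (fun δ : ℝ ↦ ENNReal.ofReal (δ ^ 2 + δ)) 0 :=
        ENNReal.continuous_ofReal.continuousAt.comp (by fun_prop)
      simpa [ContinuousAt] using this.tendsto.mono_left nhdsWithin_le_nhds
    have t3 : Tendsto (fun δ : ℝ ↦ ENNReal.ofReal (1 + δ) * B) (𝓝[>] 0) (𝓝 B) := by
      simpa using ENNReal.Tendsto.mul_const t1 (Or.inl one_ne_zero)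
    have t4 := t3.add t2
    rw [add_zero] at t4
    have t5 := ENNReal.Tendsto.mul t1 (Or.inl one_ne_zero) t4 (Or.inr ENNReal.one_ne_top)
    simpa using t5.add t2
  exact ge_of_tendsto hlim (eventually_nhdsWithin_of_forall hle)

/-- The pairs `(p, Y)` of a trigonometric polynomial `p(ω) = ∑ₛ exp (-i ω s) aₛ` and the
corresponding variable `Y = ∑ₛ aₛ · j(s)`. -/
def trigPairs (j : ℝ → Ω → (Fin 3 → ℝ)) : Submodule ℂ ((ℝ → Fin 3 → ℂ) × (Ω → ℂ)) :=
  Submodule.span ℂ (Set.range fun q : ℝ × Fin 3 ↦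
    ((fun ω ↦ Pi.single q.2 (Complex.exp (-(Complex.I * ω * q.1))), fun w ↦ (j q.1 w q.2 : ℂ)) :
      (ℝ → Fin 3 → ℂ) × (Ω → ℂ)))

/-- `(f, X)` is a limit of pairs of `trigPairs j` in the two mean square seminorms. -/
def IsTrigLimit (P : Measure Ω) (D : ℝ → Matrix (Fin 3) (Fin 3) ℂ) (j : ℝ → Ω → (Fin 3 → ℝ))
    (f : ℝ → Fin 3 → ℂ) (X : Ω → ℂ) : Prop :=
  ∀ ε : ℝ≥0∞, 0 < ε → ∃ x ∈ trigPairs j,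
    filterPower D (f - x.1) ≤ ε ∧ ∫⁻ w, ‖(X - x.2) w‖ₑ ^ 2 ∂P ≤ ε

lemma isTrigLimit_of_isSpectralIntegral {f : ℝ → Fin 3 → ℂ} {X : Ω → ℂ}
    (h : IsSpectralIntegral P D j f X) : IsTrigLimit P D j f X := by
  intro ε hε
  obtain ⟨F, a, h1, h2⟩ := h ε hε
  refine ⟨(fun ω ↦ ∑ s ∈ F, Complex.exp (-(Complex.I * ω * s)) • a s,
    fun w ↦ ∑ s ∈ F, ∑ m, a s m * ((j s w m : ℝ) : ℂ)), ?_, h1, h2⟩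
  have hsum : ((fun ω ↦ ∑ s ∈ F, Complex.exp (-(Complex.I * ω * s)) • a s,
      fun w ↦ ∑ s ∈ F, ∑ m, a s m * ((j s w m : ℝ) : ℂ)) : (ℝ → Fin 3 → ℂ) × (Ω → ℂ))
      = ∑ s ∈ F, ∑ m, a s m •
        ((fun ω ↦ Pi.single m (Complex.exp (-(Complex.I * ω * s))), fun w ↦ (j s w m : ℂ)) :
          (ℝ → Fin 3 → ℂ) × (Ω → ℂ)) := by
    refine Prod.ext ?_ ?_
    · simp only [Prod.fst_sum, Prod.smul_fst]
      ext ω n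
      simp only [Finset.sum_apply, Pi.smul_apply, smul_eq_mul, Pi.single_apply, mul_ite, mul_zero,
        Finset.sum_ite_eq, Finset.mem_univ, if_true]
      exact Finset.sum_congr rfl fun s _ ↦ mul_comm _ _
    · simp only [Prod.snd_sum, Prod.smul_snd]
      ext w
      simp only [Finset.sum_apply, Pi.smul_apply, smul_eq_mul]
  rw [hsum]
  exact Submodule.sum_mem _ fun s _ ↦ Submodule.sum_mem _ fun m _ ↦
    Submodule.smul_mem _ _ (Submodule.subset_span ⟨(s, m), rfl⟩)

lemma IsTrigLimit.add_smul (hD : ∀ ω, (D ω).PosSemidef)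
    (hDm : ∀ m n, AEMeasurable fun ω ↦ D ω m n)
    (hj : ∀ x ∈ trigPairs j, (∀ m, Measurable fun ω ↦ x.1 ω m) ∧ AEMeasurable x.2 P)
    {f g : ℝ → Fin 3 → ℂ} {X Y : Ω → ℂ} (hf : ∀ m, AEMeasurable fun ω ↦ f ω m)
    (hX : AEMeasurable X P)
    (hfX : IsTrigLimit P D j f X) (hgY : IsTrigLimit P D j g Y) (c : ℂ) :
    IsTrigLimit P D j (f + c • g) (X + c • Y) := by
  intro ε hε
  -- the constant in the triangle inequality for squared seminorms (`δ = 1`)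
  set K : ℝ≥0∞ := ENNReal.ofReal (1 + 1) + ENNReal.ofReal (1 + 1⁻¹) * ENNReal.ofReal (‖c‖ ^ 2)
    with hK
  have hK0 : K ≠ 0 := by
    rw [hK]; simp
  have hKt : K ≠ ∞ := by
    rw [hK]; finiteness
  have hη : 0 < ε / K := ENNReal.div_pos hε.ne' hKt
  obtain ⟨x, hx, hx1, hx2⟩ := hfX _ hη
  obtain ⟨y, hy, hy1, hy2⟩ := hgY _ hη
  have hKε : K * (ε / K) = ε := ENNReal.mul_div_cancel hK0 hKt
  refine ⟨x + c • y, Submodule.add_mem _ hx (Submodule.smul_mem _ _ hy), ?_, ?_⟩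
  · have e : f + c • g - (x + c • y).1 = (f - x.1) + c • (g - y.1) := by
      simp only [Prod.fst_add, Prod.smul_fst]
      module
    rw [e]
    refine (filterPower_add_le hD hDm (fun m ↦ ?_) one_pos).trans ?_
    · exact (hf m).sub ((hj x hx).1 m).aemeasurable
    rw [filterPower_smul, ← hKε, hK, add_mul, ← mul_assoc]
    gcongr
  · have e : X + c • Y - (x + c • y).2 = (X - x.2) + c • (Y - y.2) := by
      simp only [Prod.snd_add, Prod.smul_snd]
      module
    rw [e]
    refine (lintegral_enorm_add_sq_le (hX.sub (hj x hx).2) one_pos).trans ?_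
    have e2 : ∫⁻ w, ‖(c • (Y - y.2)) w‖ₑ ^ 2 ∂P
        = ENNReal.ofReal (‖c‖ ^ 2) * ∫⁻ w, ‖(Y - y.2) w‖ₑ ^ 2 ∂P := by
      rw [← lintegral_const_mul' _ _ ENNReal.ofReal_ne_top]
      refine lintegral_congr fun w ↦ ?_
      rw [Pi.smul_apply, enorm_smul, mul_pow, ← ofReal_norm c,
        ENNReal.ofReal_pow (norm_nonneg _)]
    rw [e2, ← hKε, hK, add_mul, ← mul_assoc]
    gcongr

end SpectralIsometry

/-! ### The spectral isometry -/

section SpectralCovariance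

variable {Ω : Type*} [MeasurableSpace Ω] {P : Measure Ω}
  {D : ℝ → Matrix (Fin 3) (Fin 3) ℂ} {j : ℝ → Ω → (Fin 3 → ℝ)}

/-- `j` is a square integrable signal with covariance `⟨j(s) j(s')ᵀ⟩ = ∫ exp (-i ω (s - s')) D dω`
for an integrable, positive semidefinite spectral density `D`. -/
structure HasSpectralDensity (P : Measure Ω) (D : ℝ → Matrix (Fin 3) (Fin 3) ℂ)
    (j : ℝ → Ω → (Fin 3 → ℝ)) : Prop where
  posSemidef : ∀ ω, (D ω).PosSemidef
  integrable : ∀ m n, Integrable fun ω ↦ D ω m n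
  memLp : ∀ s m, MemLp (fun w ↦ j s w m) 2 P
  covariance : ∀ s s' m n, ((∫ w, j s w m * j s' w n ∂P : ℝ) : ℂ)
    = ∫ ω : ℝ, Complex.exp (-(Complex.I * ω * (s - s'))) * D ω m n

namespace HasSpectralDensity

lemma aemeasurable (h : HasSpectralDensity P D j) (m n : Fin 3) :
    AEMeasurable fun ω ↦ D ω m n := (h.integrable m n).1.aemeasurable

lemma crossPower_single (s s' : ℝ) (m n : Fin 3) (ω : ℝ) :
    crossPower D (fun ω ↦ Pi.single m (Complex.exp (-(Complex.I * ω * s))))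
      (fun ω ↦ Pi.single n (Complex.exp (-(Complex.I * ω * s')))) ω
      = Complex.exp (-(Complex.I * ω * (s - s'))) * D ω m n := by
  have hstar : star (Pi.single n (Complex.exp (-(Complex.I * ω * s'))) : Fin 3 → ℂ)
      = Pi.single n (Complex.exp (Complex.I * ω * s')) := by
    rw [← Pi.single_star]
    congr 1
    rw [Complex.star_def, ← Complex.exp_conj]
    congr 1
    simp
  have he : Complex.exp (-(Complex.I * ω * (s - s')))
      = Complex.exp (-(Complex.I * ω * s)) * Complex.exp (Complex.I * ω * s') := by
    rw [← Complex.exp_add]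
    congr 1
    ring
  rw [crossPower, hstar, single_dotProduct, Matrix.mulVec_single, he]
  simp only [Pi.smul_apply, MulOpposite.smul_eq_mul_unop, MulOpposite.unop_op, Matrix.col_apply]
  ring

lemma norm_exp_neg_I_mul (ω u : ℝ) : ‖Complex.exp (-(Complex.I * ω * u))‖ = 1 := by
  have : -(Complex.I * ω * u) = ((-(ω * u) : ℝ) : ℂ) * Complex.I := by push_cast; ring
  rw [this, Complex.norm_exp_ofReal_mul_I]

lemma integrable_exp_mul {f : ℝ → ℂ} (hf : Integrable f) (u : ℝ) :
    Integrable fun ω : ℝ ↦ Complex.exp (-(Complex.I * ω * u)) * f ω := by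
  refine hf.bdd_mul (c := 1) (by fun_prop) (ae_of_all _ fun ω ↦ ?_)
  rw [norm_exp_neg_I_mul]

lemma trigPairs_measurable (h : HasSpectralDensity P D j) :
    ∀ x ∈ trigPairs j, (∀ m, Measurable fun ω ↦ x.1 ω m) ∧ AEMeasurable x.2 P := by
  intro x hx
  induction hx using Submodule.span_induction with
  | mem x hx =>
    obtain ⟨⟨s, n⟩, rfl⟩ := hx
    refine ⟨fun m ↦ ?_, (h.memLp s n).1.aemeasurable.complex_ofReal⟩
    simp only [Pi.single_apply]
    split_ifs <;> fun_prop
  | zero => exact ⟨fun m ↦ measurable_const, aemeasurable_const⟩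
  | add x y _ _ hx hy => exact ⟨fun m ↦ (hx.1 m).add (hy.1 m), hx.2.add hy.2⟩
  | smul c x _ hx => exact ⟨fun m ↦ (hx.1 m).const_mul c, hx.2.const_mul c⟩

/-- The correspondence between trigonometric polynomials and variables preserves the inner
product. -/
lemma trigPairs_inner (h : HasSpectralDensity P D j) {x y : (ℝ → Fin 3 → ℂ) × (Ω → ℂ)}
    (hx : x ∈ trigPairs j) (hy : y ∈ trigPairs j) :
    Integrable (crossPower D x.1 y.1) ∧ Integrable (fun w ↦ x.2 w * star (y.2 w)) P ∧
      ∫ w, x.2 w * star (y.2 w) ∂P = ∫ ω, crossPower D x.1 y.1 ω := by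
  induction hx using Submodule.span_induction with
  | mem x hx =>
    obtain ⟨⟨s, m⟩, rfl⟩ := hx
    induction hy using Submodule.span_induction with
    | mem y hy =>
      obtain ⟨⟨s', n⟩, rfl⟩ := hy
      have e1 : crossPower D (fun ω ↦ Pi.single m (Complex.exp (-(Complex.I * ω * s))))
          (fun ω ↦ Pi.single n (Complex.exp (-(Complex.I * ω * s'))))
          = fun ω : ℝ ↦ Complex.exp (-(Complex.I * ω * (s - s'))) * D ω m n :=
        funext (crossPower_single s s' m n)
      have e2 : (fun w ↦ ((j s w m : ℝ) : ℂ) * star ((j s' w n : ℝ) : ℂ))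
          = fun w ↦ ((j s w m * j s' w n : ℝ) : ℂ) := by
        ext w; simp
      simp only [e1, e2]
      refine ⟨?_, ((h.memLp s m).integrable_mul (h.memLp s' n)).ofReal, ?_⟩
      · simpa using integrable_exp_mul (h.integrable m n) (s - s')
      · rw [← h.covariance, integral_complex_ofReal]
    | zero =>
      have : crossPower D (fun ω ↦ Pi.single m (Complex.exp (-(Complex.I * ω * s))))
          (0 : ℝ → Fin 3 → ℂ) = 0 := by ext ω; simp [crossPower]
      simp [this]
    | add y z _ _ hy hz =>
      have e1 : crossPower D (fun ω ↦ Pi.single m (Complex.exp (-(Complex.I * ω * s))))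
          (y.1 + z.1) = _ := funext fun ω ↦ crossPower_add_right _ y.1 z.1 ω
      have e2 : (fun w ↦ ((j s w m : ℝ) : ℂ) * star ((y.2 + z.2) w))
          = fun w ↦ ((j s w m : ℝ) : ℂ) * star (y.2 w) + ((j s w m : ℝ) : ℂ) * star (z.2 w) := by
        ext w; simp [mul_add]
      simp only [Prod.fst_add, Prod.snd_add, e1, e2]
      refine ⟨hy.1.add hz.1, hy.2.1.add hz.2.1, ?_⟩
      rw [integral_add hy.2.1 hz.2.1, integral_add hy.1 hz.1, hy.2.2, hz.2.2]
    | smul c y _ hy =>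
      have e1 : crossPower D (fun ω ↦ Pi.single m (Complex.exp (-(Complex.I * ω * s))))
          (c • y.1) = _ := funext fun ω ↦ crossPower_smul_right c _ y.1 ω
      have e2 : (fun w ↦ ((j s w m : ℝ) : ℂ) * star ((c • y.2) w))
          = fun w ↦ star c * (((j s w m : ℝ) : ℂ) * star (y.2 w)) := by
        ext w; simp; ring
      simp only [Prod.smul_fst, Prod.smul_snd, e1, e2]
      refine ⟨hy.1.const_mul _, hy.2.1.const_mul _, ?_⟩
      rw [integral_const_mul, integral_const_mul, hy.2.2]
  | zero =>
    have : crossPower D (0 : ℝ → Fin 3 → ℂ) y.1 = 0 := by ext ω; simp [crossPower]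
    simp [this]
  | add x z _ _ hx hz =>
    have e1 : crossPower D (x.1 + z.1) y.1 = _ := funext fun ω ↦ crossPower_add_left x.1 z.1 y.1 ω
    have e2 : (fun w ↦ (x.2 + z.2) w * star (y.2 w))
        = fun w ↦ x.2 w * star (y.2 w) + z.2 w * star (y.2 w) := by
      ext w; simp [add_mul]
    simp only [Prod.fst_add, Prod.snd_add, e1, e2]
    refine ⟨hx.1.add hz.1, hx.2.1.add hz.2.1, ?_⟩
    rw [integral_add hx.2.1 hz.2.1, integral_add hx.1 hz.1, hx.2.2, hz.2.2]
  | smul c x _ hx =>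
    have e1 : crossPower D (c • x.1) y.1 = _ := funext fun ω ↦ crossPower_smul_left c x.1 y.1 ω
    have e2 : (fun w ↦ (c • x.2) w * star (y.2 w)) = fun w ↦ c * (x.2 w * star (y.2 w)) := by
      ext w; simp; ring
    simp only [Prod.smul_fst, Prod.smul_snd, e1, e2]
    refine ⟨hx.1.const_mul _, hx.2.1.const_mul _, ?_⟩
    rw [integral_const_mul, integral_const_mul, hx.2.2]

lemma trigPairs_isometry (h : HasSpectralDensity P D j) {x : (ℝ → Fin 3 → ℂ) × (Ω → ℂ)}
    (hx : x ∈ trigPairs j) :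
    ∫⁻ w, ‖x.2 w‖ₑ ^ 2 ∂P = filterPower D x.1 ∧ filterPower D x.1 ≠ ∞ := by
  obtain ⟨h1, h2, h3⟩ := h.trigPairs_inner hx hx
  have e1 : filterPower D x.1 = ENNReal.ofReal (∫ ω, (crossPower D x.1 x.1 ω).re) :=
    (ofReal_integral_eq_lintegral_ofReal h1.re
      (ae_of_all _ fun ω ↦ (Complex.le_def.1 (crossPower_self_nonneg h.posSemidef x.1 ω)).1)).symm
  have e2 : ∫⁻ w, ‖x.2 w‖ₑ ^ 2 ∂P = ENNReal.ofReal (∫ w, (x.2 w * star (x.2 w)).re ∂P) := by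
    have hre : ∀ w, (x.2 w * star (x.2 w)).re = ‖x.2 w‖ ^ 2 := fun w ↦ by
      rw [Complex.star_def, Complex.mul_conj, Complex.ofReal_re, Complex.normSq_eq_norm_sq]
    have h2re : Integrable (fun w ↦ (x.2 w * star (x.2 w)).re) P := h2.re
    rw [ofReal_integral_eq_lintegral_ofReal h2re]
    · refine lintegral_congr fun w ↦ ?_
      rw [hre, ENNReal.ofReal_pow (norm_nonneg _), ofReal_norm]
    · refine ae_of_all _ fun w ↦ ?_
      simp only [Pi.zero_apply, hre]
      positivity
  refine ⟨?_, by rw [e1]; exact ENNReal.ofReal_ne_top⟩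
  rw [e1, e2]
  congr 1
  have h4 := congrArg Complex.re h3
  rwa [← RCLike.re_eq_complex_re, ← integral_re h2, ← integral_re h1] at h4

/-- The spectral integral is an isometry on all of its domain. -/
lemma isTrigLimit_isometry (h : HasSpectralDensity P D j) {f : ℝ → Fin 3 → ℂ} {X : Ω → ℂ}
    (hf : ∀ m, AEMeasurable fun ω ↦ f ω m) (hX : AEMeasurable X P) (hfX : IsTrigLimit P D j f X) :
    ∫⁻ w, ‖X w‖ₑ ^ 2 ∂P = filterPower D f ∧ filterPower D f ≠ ∞ := by
  have key : ∀ δ : ℝ, 0 < δ → ∃ C : ℝ≥0∞, C ≠ ∞ ∧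
      (∫⁻ w, ‖X w‖ₑ ^ 2 ∂P
        ≤ ENNReal.ofReal (1 + δ) * C + ENNReal.ofReal (1 + δ⁻¹) * ENNReal.ofReal (δ ^ 2)) ∧
      (C ≤ ENNReal.ofReal (1 + δ) * (∫⁻ w, ‖X w‖ₑ ^ 2 ∂P)
        + ENNReal.ofReal (1 + δ⁻¹) * ENNReal.ofReal (δ ^ 2)) ∧
      (filterPower D f
        ≤ ENNReal.ofReal (1 + δ) * C + ENNReal.ofReal (1 + δ⁻¹) * ENNReal.ofReal (δ ^ 2)) ∧
      (C ≤ ENNReal.ofReal (1 + δ) * filterPower D f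
        + ENNReal.ofReal (1 + δ⁻¹) * ENNReal.ofReal (δ ^ 2)) := by
    intro δ hδ
    obtain ⟨x, hx, h1, h2⟩ := hfX (ENNReal.ofReal (δ ^ 2)) (by positivity)
    obtain ⟨hxm, hxY⟩ := h.trigPairs_measurable x hx
    obtain ⟨e1, e2⟩ := h.trigPairs_isometry hx
    have h1' : filterPower D (x.1 - f) = filterPower D (f - x.1) := by
      rw [← neg_sub, ← neg_one_smul ℂ, filterPower_smul]
      simp
    have h2' : ∫⁻ w, ‖(x.2 - X) w‖ₑ ^ 2 ∂P = ∫⁻ w, ‖(X - x.2) w‖ₑ ^ 2 ∂P := by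
      simp only [Pi.sub_apply, enorm_sub_rev]
    refine ⟨filterPower D x.1, e2, ?_, ?_, ?_, ?_⟩
    · have := lintegral_enorm_add_sq_le (P := P) (Y := X - x.2) hxY hδ
      rw [add_sub_cancel, e1] at this
      exact this.trans (by gcongr)
    · have := lintegral_enorm_add_sq_le (P := P) (Y := x.2 - X) hX hδ
      rw [add_sub_cancel, e1, h2'] at this
      exact this.trans (by gcongr)
    · have := filterPower_add_le h.posSemidef h.aemeasurable (g := f - x.1)
        (fun m ↦ (hxm m).aemeasurable) hδ
      rw [add_sub_cancel] at this
      exact this.trans (by gcongr)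
    · have := filterPower_add_le h.posSemidef h.aemeasurable (g := x.1 - f) hf hδ
      rw [add_sub_cancel, h1'] at this
      exact this.trans (by gcongr)
  refine ⟨le_antisymm (ennreal_le_of_forall_approx fun δ hδ ↦ ?_)
    (ennreal_le_of_forall_approx fun δ hδ ↦ ?_), ?_⟩
  · obtain ⟨C, -, h1, -, -, h4⟩ := key δ hδ
    exact ⟨C, h1, h4⟩
  · obtain ⟨C, -, -, h2, h3, -⟩ := key δ hδ
    exact ⟨C, h3, h2⟩
  · obtain ⟨C, hC, -, -, h3, -⟩ := key 1 one_pos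
    exact ne_top_of_le_ne_top (by finiteness) h3

lemma isTrigLimit_integral_self (h : HasSpectralDensity P D j) {f : ℝ → Fin 3 → ℂ} {X : Ω → ℂ}
    (hf : ∀ m, AEMeasurable fun ω ↦ f ω m) (hX : AEMeasurable X P) (hfX : IsTrigLimit P D j f X) :
    MemLp X 2 P ∧ Integrable (crossPower D f f) ∧
      ∫ w, X w * star (X w) ∂P = ∫ ω, crossPower D f f ω := by
  obtain ⟨h1, h2⟩ := h.isTrigLimit_isometry hf hX hfX
  have hL : MemLp X 2 P :=
    (memLp_two_iff_lintegral_lt_top hX.aestronglyMeasurable).2 (by rw [h1]; exact h2.lt_top)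
  have hreal : ∀ ω, crossPower D f f ω = (((crossPower D f f ω).re : ℝ) : ℂ) := fun ω ↦ by
    have := Complex.le_def.1 (crossPower_self_nonneg h.posSemidef f ω)
    exact Complex.ext rfl (by simpa using this.2.symm)
  have hnn : ∀ ω, 0 ≤ (crossPower D f f ω).re := fun ω ↦
    (Complex.le_def.1 (crossPower_self_nonneg h.posSemidef f ω)).1
  have hm : AEMeasurable fun ω ↦ (crossPower D f f ω).re :=
    Complex.measurable_re.comp_aemeasurable (aemeasurable_crossPower h.aemeasurable hf hf)
  have hint : Integrable fun ω ↦ (crossPower D f f ω).re :=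
    (lintegral_ofReal_ne_top_iff_integrable hm.aestronglyMeasurable (ae_of_all _ hnn)).1 h2
  refine ⟨hL, ?_, ?_⟩
  · refine (hint.ofReal (𝕜 := ℂ)).congr (ae_of_all _ fun ω ↦ (hreal ω).symm)
  · have e1 : ∫ ω, crossPower D f f ω = ((∫ ω, (crossPower D f f ω).re : ℝ) : ℂ) := by
      rw [← integral_complex_ofReal]
      exact integral_congr_ae (ae_of_all _ hreal)
    have e2 : ∫ w, X w * star (X w) ∂P = ((∫ w, ‖X w‖ ^ 2 ∂P : ℝ) : ℂ) := by
      rw [← integral_complex_ofReal]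
      refine integral_congr_ae (ae_of_all _ fun w ↦ ?_)
      simp only [Complex.star_def, Complex.mul_conj, Complex.normSq_eq_norm_sq]
    have hXm : AEStronglyMeasurable (fun w ↦ ‖X w‖ ^ 2) P := hL.1.norm.pow 2
    rw [e1, e2, integral_eq_lintegral_of_nonneg_ae (ae_of_all _ hnn) hm.aestronglyMeasurable,
      integral_eq_lintegral_of_nonneg_ae (ae_of_all _ fun w ↦ sq_nonneg ‖X w‖) hXm]
    congr 2
    rw [filterPower] at h1
    rw [← h1]
    refine lintegral_congr fun w ↦ ?_
    rw [ENNReal.ofReal_pow (norm_nonneg _), ofReal_norm]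

lemma integral_polarization {α : Type*} [MeasurableSpace α] {μ : Measure α} {u₁ u₂ u₃ u₄ : α → ℂ}
    (h₁ : Integrable u₁ μ) (h₂ : Integrable u₂ μ) (h₃ : Integrable u₃ μ) (h₄ : Integrable u₄ μ) :
    ∫ a, (1 / 4 : ℂ) * (u₁ a - u₂ a + Complex.I * u₃ a - Complex.I * u₄ a) ∂μ
      = (1 / 4) * ((∫ a, u₁ a ∂μ) - (∫ a, u₂ a ∂μ) + Complex.I * (∫ a, u₃ a ∂μ)
        - Complex.I * ∫ a, u₄ a ∂μ) := by
  have i₁ : Integrable (fun a ↦ u₁ a - u₂ a) μ := h₁.sub h₂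
  have i₂ : Integrable (fun a ↦ u₁ a - u₂ a + Complex.I * u₃ a) μ := i₁.add (h₃.const_mul _)
  rw [integral_const_mul, integral_sub i₂ (h₄.const_mul _), integral_add i₁ (h₃.const_mul _),
    integral_sub h₁ h₂, integral_const_mul, integral_const_mul]

/-- The isometry in polarized form: `⟨X Y^*⟩ = ∫ f D g^* dω` for spectral integrals `X` of `f` and
`Y` of `g`. -/
lemma isTrigLimit_inner (h : HasSpectralDensity P D j) {f g : ℝ → Fin 3 → ℂ} {X Y : Ω → ℂ}
    (hf : ∀ m, AEMeasurable fun ω ↦ f ω m) (hg : ∀ m, AEMeasurable fun ω ↦ g ω m)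
    (hX : AEMeasurable X P) (hY : AEMeasurable Y P)
    (hfX : IsTrigLimit P D j f X) (hgY : IsTrigLimit P D j g Y) :
    Integrable (crossPower D f g) ∧
      ∫ w, X w * star (Y w) ∂P = ∫ ω, crossPower D f g ω := by
  have key : ∀ c : ℂ, Integrable (crossPower D (f + c • g) (f + c • g)) ∧
      Integrable (fun w ↦ (X + c • Y) w * star ((X + c • Y) w)) P ∧
      ∫ w, (X + c • Y) w * star ((X + c • Y) w) ∂P
        = ∫ ω, crossPower D (f + c • g) (f + c • g) ω := by
    intro c
    obtain ⟨h1, h2, h3⟩ := h.isTrigLimit_integral_self (f := f + c • g) (X := X + c • Y)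
      (fun m ↦ (hf m).add ((hg m).const_mul c)) (hX.add (hY.const_mul c))
      (hfX.add_smul h.posSemidef h.aemeasurable h.trigPairs_measurable hf hX hgY c)
    exact ⟨h2, h1.integrable_mul h1.star, h3⟩
  have hpol : ∀ ω, crossPower D f g ω = (1 / 4) *
      (crossPower D (f + (1 : ℂ) • g) (f + (1 : ℂ) • g) ω
      - crossPower D (f + (-1 : ℂ) • g) (f + (-1 : ℂ) • g) ω
      + Complex.I * crossPower D (f + Complex.I • g) (f + Complex.I • g) ω
      - Complex.I * crossPower D (f + (-Complex.I) • g) (f + (-Complex.I) • g) ω) := by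
    intro ω
    simp only [crossPower_self_add_smul]
    simp
    linear_combination (1 / 2 * crossPower D f g ω - 1 / 2 * crossPower D g f ω) * Complex.I_sq
  have hpol' : ∀ w, X w * star (Y w) = (1 / 4) *
      ((X + (1 : ℂ) • Y) w * star ((X + (1 : ℂ) • Y) w)
      - (X + (-1 : ℂ) • Y) w * star ((X + (-1 : ℂ) • Y) w)
      + Complex.I * ((X + Complex.I • Y) w * star ((X + Complex.I • Y) w))
      - Complex.I * ((X + (-Complex.I) • Y) w * star ((X + (-Complex.I) • Y) w))) := by
    intro w
    simp
    linear_combination (1 / 2 * X w * (starRingEnd ℂ) (Y w)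
      - 1 / 2 * Y w * (starRingEnd ℂ) (X w)) * Complex.I_sq
  obtain ⟨a1, b1, c1⟩ := key 1
  obtain ⟨a2, b2, c2⟩ := key (-1)
  obtain ⟨a3, b3, c3⟩ := key Complex.I
  obtain ⟨a4, b4, c4⟩ := key (-Complex.I)
  rw [funext hpol, funext hpol']
  refine ⟨(((a1.sub a2).add (a3.const_mul _)).sub (a4.const_mul _)).const_mul _, ?_⟩
  rw [integral_polarization b1 b2 b3 b4, integral_polarization a1 a2 a3 a4, c1, c2, c3, c4]

end HasSpectralDensity

end SpectralCovariance

/-! ### Spectral integrals of Gaussian processes -/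

section GaussianSpan

variable {Ω : Type*} [MeasurableSpace Ω] {P : Measure Ω}
  {D : ℝ → Matrix (Fin 3) (Fin 3) ℂ} {j : ℝ → Ω → (Fin 3 → ℝ)}

/-- The real linear span in `L²(P)` of the components of the variables `j(t)`. -/
def linearSpan (hL : ∀ s m, MemLp (fun w ↦ j s w m) 2 P) : Submodule ℝ (Lp ℝ 2 P) :=
  Submodule.span ℝ (Set.range fun q : ℝ × Fin 3 ↦ (hL q.1 q.2).toLp)

lemma isCenteredGaussianSubspace_linearSpan [IsProbabilityMeasure P] (hG : IsGaussianProcess j P)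
    (h0 : ∀ t m, ∫ w, j t w m ∂P = 0) (hL : ∀ s m, MemLp (fun w ↦ j s w m) 2 P) :
    IsCenteredGaussianSubspace (linearSpan hL) := by
  intro Z hZ
  obtain ⟨c, rfl⟩ := (Finsupp.mem_span_range_iff_exists_finsupp).1 hZ
  set Z : Lp ℝ 2 P := c.sum fun q r ↦ r • (hL q.1 q.2).toLp with hZdef
  have hproc : IsGaussianProcess (fun (q : ℝ × Fin 3) w ↦ c q * j q.1 w q.2) P := by
    refine hG.of_isGaussianProcess fun q ↦ ⟨{q.1},
      c q • ((ContinuousLinearMap.proj (R := ℝ) (φ := fun _ : Fin 3 ↦ ℝ) q.2).comp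
        (ContinuousLinearMap.proj (R := ℝ) (φ := fun _ : ({q.1} : Finset ℝ) ↦ Fin 3 → ℝ)
          ⟨q.1, by simp⟩)), fun w ↦ ?_⟩
    simp
  have hlaw := hproc.hasGaussianLaw_fun_sum (I := c.support)
  have hae : Z =ᵐ[P] fun w ↦ ∑ q ∈ c.support, c q * j q.1 w q.2 := by
    have h1 : ∀ᵐ w ∂P, ∀ q ∈ c.support, (c q • (hL q.1 q.2).toLp : Lp ℝ 2 P) w
        = c q * j q.1 w q.2 := by
      refine (Finset.eventually_all _).2 fun q _ ↦ ?_
      filter_upwards [Lp.coeFn_smul (c q) (hL q.1 q.2).toLp, (hL q.1 q.2).coeFn_toLp] with w h2 h3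
      rw [h2, Pi.smul_apply, h3, smul_eq_mul]
    have h2 : Z =ᵐ[P] ∑ q ∈ c.support, ⇑(c q • (hL q.1 q.2).toLp : Lp ℝ 2 P) := by
      rw [hZdef, Finsupp.sum]
      exact Lp.coeFn_finsetSum _ _
    filter_upwards [h1, h2] with w h1 h2
    rw [h2, Finset.sum_apply]
    exact Finset.sum_congr rfl h1
  have hlawZ : HasGaussianLaw Z P := hlaw.congr hae.symm
  have hmean : ∫ w, Z w ∂P = 0 := by
    rw [integral_congr_ae hae, integral_finsetSum _ fun q _ ↦
      ((hL q.1 q.2).integrable one_le_two).const_mul _]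
    simp [integral_const_mul, h0]
  have hvar : Var[Z; P] = ‖Z‖ ^ 2 := by
    rw [variance_of_integral_eq_zero (Lp.aestronglyMeasurable Z).aemeasurable hmean,
      ← real_inner_self_eq_norm_sq, L2.inner_def]
    simp [sq]
  rw [hlawZ.map_eq_gaussianReal, hmean, hvar]
  congr 1
  ext
  simp

/-- Taking real and imaginary parts, the variables in `trigPairs j` belong to the real span. -/
lemma exists_linearSpan_ae_eq (hL : ∀ s m, MemLp (fun w ↦ j s w m) 2 P)
    {x : (ℝ → Fin 3 → ℂ) × (Ω → ℂ)} (hx : x ∈ trigPairs j) :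
    (∃ Z ∈ linearSpan hL, Z =ᵐ[P] fun w ↦ (x.2 w).re) ∧
      ∃ Z ∈ linearSpan hL, Z =ᵐ[P] fun w ↦ (x.2 w).im := by
  induction hx using Submodule.span_induction with
  | mem x hx =>
    obtain ⟨⟨s, m⟩, rfl⟩ := hx
    refine ⟨⟨(hL s m).toLp, Submodule.subset_span ⟨(s, m), rfl⟩, ?_⟩,
      ⟨0, Submodule.zero_mem _, ?_⟩⟩
    · simpa using (hL s m).coeFn_toLp
    · simpa using! Lp.coeFn_zero ℝ 2 P
  | zero =>
    refine ⟨⟨0, Submodule.zero_mem _, ?_⟩, ⟨0, Submodule.zero_mem _, ?_⟩⟩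
    · simpa using! Lp.coeFn_zero ℝ 2 P
    · simpa using! Lp.coeFn_zero ℝ 2 P
  | add x y _ _ hx hy =>
    obtain ⟨⟨A, hA, hA'⟩, ⟨B, hB, hB'⟩⟩ := hx
    obtain ⟨⟨A₂, hA₂, hA₂'⟩, ⟨B₂, hB₂, hB₂'⟩⟩ := hy
    refine ⟨⟨A + A₂, Submodule.add_mem _ hA hA₂, ?_⟩, ⟨B + B₂, Submodule.add_mem _ hB hB₂, ?_⟩⟩
    · filter_upwards [Lp.coeFn_add A A₂, hA', hA₂'] with w h1 h2 h3
      rw [h1, Pi.add_apply, h2, h3]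
      simp
    · filter_upwards [Lp.coeFn_add B B₂, hB', hB₂'] with w h1 h2 h3
      rw [h1, Pi.add_apply, h2, h3]
      simp
  | smul c x _ hx =>
    obtain ⟨⟨A, hA, hA'⟩, ⟨B, hB, hB'⟩⟩ := hx
    refine ⟨⟨c.re • A - c.im • B, Submodule.sub_mem _ (Submodule.smul_mem _ _ hA)
      (Submodule.smul_mem _ _ hB), ?_⟩, ⟨c.re • B + c.im • A, Submodule.add_mem _
      (Submodule.smul_mem _ _ hB) (Submodule.smul_mem _ _ hA), ?_⟩⟩
    · filter_upwards [Lp.coeFn_sub (c.re • A) (c.im • B), Lp.coeFn_smul c.re A,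
        Lp.coeFn_smul c.im B, hA', hB'] with w h1 h2 h3 h4 h5
      rw [h1, Pi.sub_apply, h2, h3, Pi.smul_apply, Pi.smul_apply, h4, h5]
      simp
    · filter_upwards [Lp.coeFn_add (c.re • B) (c.im • A), Lp.coeFn_smul c.re B,
        Lp.coeFn_smul c.im A, hA', hB'] with w h1 h2 h3 h4 h5
      rw [h1, Pi.add_apply, h2, h3, Pi.smul_apply, Pi.smul_apply, h4, h5]
      simp

/-- A real spectral integral is a mean square limit of real linear combinations of the variables
`j(t)`: the real parts of the approximating variables approximate it at least as well. -/
lemma IsTrigLimit.toLp_mem_closure (hL : ∀ s m, MemLp (fun w ↦ j s w m) 2 P)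
    {f : ℝ → Fin 3 → ℂ} {X : Ω → ℝ} (h : IsTrigLimit P D j f fun w ↦ (X w : ℂ))
    (hX : MemLp X 2 P) : hX.toLp ∈ (linearSpan hL).topologicalClosure := by
  rw [← SetLike.mem_coe, Submodule.topologicalClosure_coe, EMetric.mem_closure_iff]
  intro ε hε
  obtain ⟨η, hη, hηε⟩ : ∃ η : ℝ≥0∞, 0 < η ∧ η < ε := exists_between hε
  obtain ⟨x, hx, -, hx2⟩ := h (η ^ 2) (by positivity)
  obtain ⟨⟨Z, hZ, hZ'⟩, -⟩ := exists_linearSpan_ae_eq hL hx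
  refine ⟨Z, hZ, lt_of_le_of_lt ?_ hηε⟩
  rw [Lp.edist_def]
  have hle : eLpNorm (⇑hX.toLp - ⇑Z) 2 P ^ 2 ≤ η ^ 2 := by
    rw [← lintegral_enorm_sq_eq]
    refine le_trans (lintegral_mono_ae ?_) hx2
    filter_upwards [hX.coeFn_toLp, hZ'] with w h1 h2
    gcongr
    rw [Pi.sub_apply, Pi.sub_apply, h1, h2, enorm_le_iff_norm_le, Real.norm_eq_abs]
    simpa using Complex.abs_re_le_norm ((X w : ℂ) - x.2 w)
  exact (ENNReal.pow_le_pow_left_iff two_ne_zero).1 hle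

end GaussianSpan

/-! ### The spectral density of the field -/

lemma crossCorr_apply {Ω : Type*} {E : ℝ → Ω → (Fin 3 → ℝ)} (τ t : ℝ) (w : Ω) (a b : Fin 2) :
    crossCorr E τ t w a b = E (t + τ) w a.castSucc * E t w b.castSucc := by
  rw [crossCorr]
  fin_cases a <;> fin_cases b <;>
    simp [Matrix.mul_apply, Fin.sum_univ_three, Upar, Matrix.vecMulVec_apply]

section BornField

variable {Ω : Type*} [MeasurableSpace Ω] {P : Measure Ω}
  {Us : Matrix (Fin 3) (Fin 2) ℝ} {J : ℝ → Matrix (Fin 2) (Fin 2) ℂ} {j : ℝ → Ω → (Fin 3 → ℝ)}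
  {S : Scene} {x : Point} {E : ℝ → Ω → (Fin 3 → ℝ)}

lemma sourceDensity_posSemidef (hJ : IsSourceSpectrum J) (ω : ℝ) :
    (sourceDensity Us J ω).PosSemidef :=
  (hJ.posSemidef ω).mul_mul_conjTranspose_same _

lemma mul_mul_apply (A : Matrix (Fin 3) (Fin 2) ℂ) (M : Matrix (Fin 2) (Fin 2) ℂ)
    (B : Matrix (Fin 2) (Fin 3) ℂ) (m n : Fin 3) :
    (A * M * B) m n = ∑ l, ∑ k, A m k * M k l * B l n := by
  simp only [Matrix.mul_apply, Finset.sum_mul]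

/-- The covariance of the source at the times `s`, `s'`, with `U_s` taken into the integral. -/
lemma IsGaussianSource.hasSpectralDensity (hJ : IsSourceSpectrum J)
    (hj : IsGaussianSource P Us J j) : HasSpectralDensity P (sourceDensity Us J) j where
  posSemidef := sourceDensity_posSemidef hJ
  integrable m n := by
    simp only [sourceDensity, mul_mul_apply]
    exact integrable_finsetSum _ fun l _ ↦ integrable_finsetSum _ fun k _ ↦
      ((hJ.integrable k l).const_mul _).mul_const _
  memLp s m := ((hj.gaussian.hasGaussianLaw_eval s).eval m).memLp_two
  covariance s s' m n := by
    have h := hj.covariance s' (s - s') m n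
    rw [add_sub_cancel] at h
    rw [h, mul_mul_apply]
    have hk : ∀ k l, Integrable fun ω : ℝ ↦ toC Us m k *
        (Complex.exp (-(Complex.I * ω * (s - s' : ℝ))) * J ω k l) * (toC Us)ᴴ l n := fun k l ↦
      ((HasSpectralDensity.integrable_exp_mul (hJ.integrable k l) (s - s')).const_mul _).mul_const _
    have e : ∀ ω : ℝ, Complex.exp (-(Complex.I * ω * (s - s'))) * sourceDensity Us J ω m n
        = ∑ l, ∑ k, toC Us m k * (Complex.exp (-(Complex.I * ω * (s - s' : ℝ))) * J ω k l)
          * (toC Us)ᴴ l n := by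
      intro ω
      rw [sourceDensity, mul_mul_apply, Finset.mul_sum]
      refine Finset.sum_congr rfl fun l _ ↦ ?_
      rw [Finset.mul_sum]
      refine Finset.sum_congr rfl fun k _ ↦ ?_
      push_cast
      ring
    simp_rw [e]
    rw [integral_finsetSum _ fun l _ ↦ integrable_finsetSum _ fun k _ ↦ hk k l]
    refine Finset.sum_congr rfl fun l _ ↦ ?_
    rw [integral_finsetSum _ fun k _ ↦ hk k l]
    refine Finset.sum_congr rfl fun k _ ↦ ?_
    rw [integral_mul_const, integral_const_mul]
    simp [timeDomain]

/-- Division by zero gives the value `0`, so this holds for `x = y` and at `ω = 0` too. -/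
lemma measurable_dyadicGreen (x y : Point) (c : ℝ) (i k : Fin 3) :
    Measurable fun ω : ℝ ↦ dyadicGreen x y (ω / c) i k := by
  simp only [dyadicGreen, scalarGreen, mFactor, Matrix.smul_apply, Matrix.sub_apply, smul_eq_mul]
  fun_prop

lemma measurable_bornTransfer (S : Scene) (x : Point) (i k : Fin 3) :
    Measurable fun ω ↦ S.bornTransfer x ω i k := by
  simp only [Scene.bornTransfer, Scene.response, Matrix.add_apply, Matrix.sum_apply,
    Matrix.mul_apply]
  refine (measurable_dyadicGreen _ _ _ _ _).add (Finset.measurable_fun_sum _ fun n _ ↦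
    Finset.measurable_fun_sum _ fun l _ ↦ (Finset.measurable_fun_sum _ fun m _ ↦ ?_).mul
      (measurable_dyadicGreen _ _ _ _ _))
  exact (measurable_dyadicGreen _ _ _ _ _).mul (S.α_measurable n m l)

/-- The filter that takes the source signal to the component `E(x,t)_i` of the field. -/
noncomputable def fieldFilter (S : Scene) (x : Point) (t : ℝ) (i : Fin 3) (ω : ℝ) (m : Fin 3) : ℂ :=
  Complex.exp (-(Complex.I * (ω : ℂ) * ((t : ℝ) : ℂ))) * S.bornTransfer x ω i m

lemma aemeasurable_fieldFilter (t : ℝ) (i m : Fin 3) :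
    AEMeasurable fun ω ↦ fieldFilter S x t i ω m := by
  have := measurable_bornTransfer S x i m
  unfold fieldFilter
  fun_prop

/-- The spectral density matrix `(G + Π) U_s J̃_s U_s^* (G + Π)^*` of the field. -/
noncomputable def fieldDensity (S : Scene) (Us : Matrix (Fin 3) (Fin 2) ℝ) (J : ℝ → Matrix (Fin 2) (Fin 2) ℂ)
    (x : Point) (ω : ℝ) : Matrix (Fin 3) (Fin 3) ℂ :=
  S.bornTransfer x ω * sourceDensity Us J ω * (S.bornTransfer x ω)ᴴ

lemma crossPower_fieldFilter (t s : ℝ) (i k : Fin 3) (ω : ℝ) :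
    crossPower (sourceDensity Us J) (fieldFilter S x t i) (fieldFilter S x s k) ω
      = Complex.exp (-(Complex.I * ω * ((t - s : ℝ) : ℂ))) * fieldDensity S Us J x ω i k := by
  have h1 : crossPower (sourceDensity Us J) (fieldFilter S x t i) (fieldFilter S x s k) ω
      = Complex.exp (-(Complex.I * ω * t)) * star (Complex.exp (-(Complex.I * ω * s)))
        * crossPower (sourceDensity Us J) (fun ω ↦ S.bornTransfer x ω i)
          (fun ω ↦ S.bornTransfer x ω k) ω := by
    have e : ∀ t i, fieldFilter S x t i ω
        = Complex.exp (-(Complex.I * ω * t)) • S.bornTransfer x ω i := fun t i ↦ rfl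
    simp only [crossPower, e, star_smul, Matrix.mulVec_smul, smul_dotProduct, dotProduct_smul,
      smul_eq_mul]
    ring
  have h2 : Complex.exp (-(Complex.I * ω * t)) * star (Complex.exp (-(Complex.I * ω * s)))
      = Complex.exp (-(Complex.I * ω * ((t - s : ℝ) : ℂ))) := by
    rw [Complex.star_def, ← Complex.exp_conj, ← Complex.exp_add]
    congr 1
    simp
    ring
  rw [h1, h2]
  congr 1
  simp only [crossPower, fieldDensity, Matrix.mul_apply, dotProduct, Matrix.mulVec,
    Matrix.conjTranspose_apply, Pi.star_apply, Finset.mul_sum, Finset.sum_mul]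
  rw [Finset.sum_comm]
  refine Finset.sum_congr rfl fun l _ ↦ Finset.sum_congr rfl fun m _ ↦ ?_
  ring

/-- `U_∥` selects the first two components. -/
lemma coherency_apply (ω : ℝ) (a b : Fin 2) :
    coherency S Us J x ω a b = fieldDensity S Us J x ω a.castSucc b.castSucc := by
  rw [coherency, ← fieldDensity]
  fin_cases a <;> fin_cases b <;>
    simp [Matrix.mul_apply, Fin.sum_univ_three, toC, Upar]

/-- An off-diagonal entry is bounded by diagonal ones, since the `2 × 2` minors are nonnegative. -/
lemma norm_apply_le_of_posSemidef {n : Type*} {M : Matrix n n ℂ}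
    (hM : M.PosSemidef) (i k : n) : ‖M i k‖ ≤ ‖M i i‖ + ‖M k k‖ := by
  have h := (Complex.le_def.1 (hM.submatrix ![i, k]).det_nonneg).1
  have hki : M k i = star (M i k) := (hM.isHermitian.apply k i).symm
  have hi := Complex.le_def.1 (hM.diag_nonneg (i := i))
  have hk := Complex.le_def.1 (hM.diag_nonneg (i := k))
  have h2 : ‖M i k‖ ^ 2 ≤ (M i i).re * (M k k).re := by
    rw [Matrix.det_fin_two] at h
    simp only [Matrix.submatrix_apply, Matrix.cons_val_zero, Matrix.cons_val_one, hki,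
      Complex.star_def, Complex.mul_conj, Complex.normSq_eq_norm_sq, Complex.sub_re,
      Complex.mul_re, Complex.ofReal_re, Complex.zero_re] at h
    simp only [Complex.zero_im] at *
    rw [← hi.2, zero_mul] at h
    linarith
  have hi' := Complex.re_le_norm (M i i)
  have hk' := Complex.re_le_norm (M k k)
  have h3 : ‖M i k‖ ^ 2 ≤ ‖M i i‖ * ‖M k k‖ :=
    h2.trans (mul_le_mul hi' hk' hk.1 (norm_nonneg _))
  refine abs_le_of_sq_le_sq' ?_ (by positivity) |>.2
  nlinarith [norm_nonneg (M i i), norm_nonneg (M k k)]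

lemma fieldDensity_posSemidef (hJ : IsSourceSpectrum J) (ω : ℝ) :
    (fieldDensity S Us J x ω).PosSemidef :=
  (sourceDensity_posSemidef hJ ω).mul_mul_conjTranspose_same _

lemma IsBornField.measurable_apply (hE : IsBornField P S Us J j x E) (t : ℝ) (i : Fin 3) :
    Measurable fun w ↦ E t w i :=
  (measurable_pi_apply i).comp (hE.measurable.comp measurable_prodMk_left)

lemma IsBornField.isTrigLimit (hE : IsBornField P S Us J j x E) (t : ℝ) (i : Fin 3) :
    IsTrigLimit P (sourceDensity Us J) j (fieldFilter S x t i) (fun w ↦ ((E t w i : ℝ) : ℂ)) :=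
  isTrigLimit_of_isSpectralIntegral (hE.spectral t i)

lemma IsBornField.memLp_two [IsProbabilityMeasure P] (hJ : IsSourceSpectrum J) (hj : IsGaussianSource P Us J j)
    (hE : IsBornField P S Us J j x E) (t : ℝ) (i : Fin 3) : MemLp (fun w ↦ E t w i) 2 P := by
  have h := ((hj.hasSpectralDensity hJ).isTrigLimit_integral_self
    (fun m ↦ aemeasurable_fieldFilter t i m)
    (hE.measurable_apply t i).complex_ofReal.aemeasurable (hE.isTrigLimit t i)).1
  simpa using h.re

/-- The field is stationary with spectral density matrix `fieldDensity`. -/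
lemma IsBornField.covariance [IsProbabilityMeasure P] (hJ : IsSourceSpectrum J) (hj : IsGaussianSource P Us J j)
    (hE : IsBornField P S Us J j x E) (t s : ℝ) (i k : Fin 3) :
    Integrable (fun ω : ℝ ↦ Complex.exp (-(Complex.I * ω * ((t - s : ℝ) : ℂ)))
        * fieldDensity S Us J x ω i k) ∧
      ((∫ w, E t w i * E s w k ∂P : ℝ) : ℂ)
        = ∫ ω : ℝ, Complex.exp (-(Complex.I * ω * ((t - s : ℝ) : ℂ)))
          * fieldDensity S Us J x ω i k := by
  have h := (hj.hasSpectralDensity hJ).isTrigLimit_inner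
    (fun m ↦ aemeasurable_fieldFilter t i m) (fun m ↦ aemeasurable_fieldFilter s k m)
    (hE.measurable_apply t i).complex_ofReal.aemeasurable
    (hE.measurable_apply s k).complex_ofReal.aemeasurable
    (hE.isTrigLimit t i) (hE.isTrigLimit s k)
  rw [funext (crossPower_fieldFilter t s i k)] at h
  refine ⟨h.1, ?_⟩
  rw [← h.2, ← integral_complex_ofReal]
  simp

end BornField

/-! ### Statistical stability -/

section Ergodicity

variable {Ω : Type*} [MeasurableSpace Ω] {P : Measure Ω} [IsProbabilityMeasure P]
  {Us : Matrix (Fin 3) (Fin 2) ℝ} {J : ℝ → Matrix (Fin 2) (Fin 2) ℂ} {j : ℝ → Ω → (Fin 3 → ℝ)}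
  {S : Scene} {x : Point} {E : ℝ → Ω → (Fin 3 → ℝ)}

lemma IsBornField.integral_mul_eq (hJ : IsSourceSpectrum J) (hj : IsGaussianSource P Us J j)
    (hE : IsBornField P S Us J j x E) (t s : ℝ) (i k : Fin 3) :
    ∫ w, E t w i * E s w k ∂P = ∫ w, E (t - s) w i * E 0 w k ∂P := by
  have h1 := (hE.covariance hJ hj t s i k).2
  have h2 := (hE.covariance hJ hj (t - s) 0 i k).2
  rw [sub_zero, ← h1] at h2
  exact_mod_cast h2.symm

/-- The components of the field have finite fourth moments and obey Isserlis' formula, because they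
lie in the closed linear span of the Gaussian source. -/
lemma IsBornField.isserlis (hJ : IsSourceSpectrum J) (hj : IsGaussianSource P Us J j)
    (hE : IsBornField P S Us J j x E) :
    (∀ t i, MemLp (fun w ↦ E t w i) 4 P) ∧
      ∀ t₁ t₂ t₃ t₄ i₁ i₂ i₃ i₄,
        ∫ w, E t₁ w i₁ * E t₂ w i₂ * (E t₃ w i₃ * E t₄ w i₄) ∂P
        = (∫ w, E t₁ w i₁ * E t₂ w i₂ ∂P) * (∫ w, E t₃ w i₃ * E t₄ w i₄ ∂P)
          + (∫ w, E t₁ w i₁ * E t₃ w i₃ ∂P) * (∫ w, E t₂ w i₂ * E t₄ w i₄ ∂P)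
          + (∫ w, E t₁ w i₁ * E t₄ w i₄ ∂P) * (∫ w, E t₂ w i₂ * E t₃ w i₃ ∂P) := by
  have hL := (hj.hasSpectralDensity hJ).memLp
  have hV := (isCenteredGaussianSubspace_linearSpan hj.gaussian hj.mean_zero hL).topologicalClosure
  have h2 := hE.memLp_two hJ hj
  have hmem : ∀ t i, (h2 t i).toLp ∈ (linearSpan hL).topologicalClosure := fun t i ↦
    (hE.isTrigLimit t i).toLp_mem_closure hL (h2 t i)
  have hinner : ∀ t s i k, inner ℝ (h2 t i).toLp (h2 s k).toLp = ∫ w, E t w i * E s w k ∂P := by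
    intro t s i k
    rw [L2.inner_def]
    refine integral_congr_ae ?_
    filter_upwards [(h2 t i).coeFn_toLp, (h2 s k).coeFn_toLp] with w hw1 hw2
    rw [hw1, hw2]
    simp [mul_comm]
  refine ⟨fun t i ↦ (memLp_congr_ae (h2 t i).coeFn_toLp).1 (hV.memLp_four (hmem t i)), ?_⟩
  intro t₁ t₂ t₃ t₄ i₁ i₂ i₃ i₄
  have h := hV.integral_mul_mul_mul (hmem t₁ i₁) (hmem t₂ i₂) (hmem t₃ i₃) (hmem t₄ i₄)
  simp only [hinner] at h
  rw [← h]
  refine integral_congr_ae ?_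
  filter_upwards [(h2 t₁ i₁).coeFn_toLp, (h2 t₂ i₂).coeFn_toLp, (h2 t₃ i₃).coeFn_toLp,
    (h2 t₄ i₄).coeFn_toLp] with w e1 e2 e3 e4
  rw [e1, e2, e3, e4]

lemma IsBornField.memLp_two_mul (hJ : IsSourceSpectrum J) (hj : IsGaussianSource P Us J j)
    (hE : IsBornField P S Us J j x E) (t s : ℝ) (i k : Fin 3) :
    MemLp (fun w ↦ E t w i * E s w k) 2 P := by
  have h4 := (hE.isserlis hJ hj).1
  have : ENNReal.HolderTriple 4 4 2 := by
    refine ⟨?_⟩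
    rw [← ENNReal.toReal_eq_toReal_iff' (by simp) (by simp), ENNReal.toReal_add (by simp) (by simp)]
    norm_num
  exact (h4 s k).mul (h4 t i)

lemma memLp_two_coherency (hJ : IsSourceSpectrum J)
    (hψ : ∀ a, MemLp (fun ω => coherency S Us J x ω a a) 2 volume) (a b : Fin 2)
    (hm : AEStronglyMeasurable (fun ω => coherency S Us J x ω a b) volume) :
    MemLp (fun ω => coherency S Us J x ω a b) 2 volume := by
  refine MemLp.mono ((hψ a).norm.add (hψ b).norm) hm (ae_of_all _ fun ω ↦ ?_)
  simp only [Pi.add_apply, coherency_apply]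
  exact (norm_apply_le_of_posSemidef (fieldDensity_posSemidef hJ ω) _ _).trans (le_abs_self _)

/-- The covariance function of two transverse components of the field is square integrable over
the time lags, by Plancherel's theorem. -/
lemma IsBornField.memLp_two_covariance (hJ : IsSourceSpectrum J) (hj : IsGaussianSource P Us J j)
    (hE : IsBornField P S Us J j x E)
    (hψ : ∀ a, MemLp (fun ω => coherency S Us J x ω a a) 2 volume) (a b : Fin 2) :
    MemLp (fun u : ℝ ↦ ∫ w, E u w a.castSucc * E 0 w b.castSucc ∂P) 2 volume := by
  have h1 : Integrable fun ω ↦ coherency S Us J x ω a b := by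
    have := (hE.covariance hJ hj 0 0 a.castSucc b.castSucc).1
    simpa [coherency_apply] using this
  have h := (memLp_two_integral_exp_mul h1 (memLp_two_coherency hJ hψ a b h1.1)).re
  refine (memLp_congr_ae (ae_of_all _ fun u ↦ ?_)).1 h
  have h2 := (hE.covariance hJ hj u 0 a.castSucc b.castSucc).2
  rw [sub_zero] at h2
  simp only [coherency_apply, ← h2]
  exact Complex.ofReal_re _

end Ergodicity

end StatStab

theorem mainTheorem8 {Ω : Type*} [MeasurableSpace Ω] (P : Measure Ω) [IsProbabilityMeasure P]
    (S : Scene) (Us : Matrix (Fin 3) (Fin 2) ℝ) (hUs : Usᵀ * Us = 1)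
    (J : ℝ → Matrix (Fin 2) (Fin 2) ℂ) (hJ : IsSourceSpectrum J)
    (j : ℝ → Ω → (Fin 3 → ℝ)) (hj : IsGaussianSource P Us J j)
    (xr : Point) (hxs : xr ≠ S.xs) (hy : ∀ n, xr ≠ S.y n)
    (E : ℝ → Ω → (Fin 3 → ℝ)) (hE : IsBornField P S Us J j xr E)
    (hψ : ∀ a, MemLp (fun ω => coherency S Us J xr ω a a) 2 volume)
    (τ : ℝ) (a b : Fin 2) :
    Integrable (fun ω : ℝ => Complex.exp (-(Complex.I * ω * τ)) * coherency S Us J xr ω a b) ∧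
    (∀ T : ℝ, 0 < T →
      (∀ᵐ w ∂P, IntervalIntegrable (fun t => crossCorr E τ t w a b) volume (-T) T) ∧
      MemLp (fun w => empAutocorr E T τ w a b) 2 P ∧
      ((∫ w, empAutocorr E T τ w a b ∂P : ℝ) : ℂ) =
        ∫ ω : ℝ, Complex.exp (-(Complex.I * ω * τ)) * coherency S Us J xr ω a b) ∧
    (fun T : ℝ => Var[fun w => empAutocorr E T τ w a b; P]) =O[atTop] (fun T : ℝ => 1 / T) ∧
    Tendsto (fun T : ℝ => eLpNorm (fun w => ((empAutocorr E T τ w a b : ℝ) : ℂ) -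
        ∫ ω : ℝ, Complex.exp (-(Complex.I * ω * τ)) * coherency S Us J xr ω a b) 2 P)
      atTop (𝓝 0) ∧
    TendstoInMeasure P (fun (T : ℝ) w => ((empAutocorr E T τ w a b : ℝ) : ℂ)) atTop
      (fun _ => ∫ ω : ℝ, Complex.exp (-(Complex.I * ω * τ)) * coherency S Us J xr ω a b) := by
  have hsub : ∀ t s u : ℝ, ∀ i k, t - s = u →
      ∫ w, E t w i * E s w k ∂P = ∫ w, E u w i * E 0 w k ∂P := by
    rintro t s u i k rfl
    exact hE.integral_mul_eq hJ hj t s i k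
  set C : Fin 2 → Fin 2 → ℝ → ℝ := fun a b u ↦ ∫ w, E u w a.castSucc * E 0 w b.castSucc ∂P with hC
  have hCL : ∀ a b, MemLp (C a b) 2 volume := hE.memLp_two_covariance hJ hj hψ
  have hcov := hE.covariance hJ hj τ 0 a.castSucc b.castSucc
  rw [sub_zero] at hcov
  have hCτ : ∫ ω : ℝ, Complex.exp (-(Complex.I * ω * τ)) * coherency S Us J xr ω a b
      = ((C a b τ : ℝ) : ℂ) := by
    simp only [coherency_apply]
    exact hcov.2.symm
  -- the covariance function of the products `E_a(t + τ) E_b(t)`, given by Isserlis' formula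
  set R : ℝ → ℝ := fun u ↦ C a a u * C b b u + C a b (u + τ) * C b a (u - τ) with hR
  have hRint : Integrable R := by
    have hshift : ∀ (a b : Fin 2) (v : ℝ), MemLp (fun u ↦ C a b (u + v)) 2 volume := fun a b v ↦
      (hCL a b).comp_measurePreserving (measurePreserving_add_right volume v)
    have hsh : MemLp (fun u ↦ C b a (u - τ)) 2 volume := by
      simpa only [sub_eq_add_neg] using hshift b a (-τ)
    exact ((hCL a a).integrable_mul (hCL b b)).add ((hshift a b τ).integrable_mul hsh)
  have hX : Measurable (Function.uncurry fun t w ↦ crossCorr E τ t w a b) := by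
    simp only [crossCorr_apply]
    have h1 : Measurable fun p : ℝ × Ω ↦ E (p.1 + τ) p.2 :=
      hE.measurable.comp ((measurable_fst.add_const τ).prodMk measurable_snd)
    exact ((measurable_pi_apply a.castSucc).comp h1).mul
      ((measurable_pi_apply b.castSucc).comp hE.measurable)
  obtain ⟨hmean, hvar, hlim⟩ := timeAverage_tendsto (P := P)
    (X := fun t w ↦ crossCorr E τ t w a b) (R := R) (m := C a b τ) hX
    (fun t ↦ by
      simp only [crossCorr_apply]
      exact hsub _ _ _ _ _ (by ring))
    (fun t ↦ by
      simp only [crossCorr_apply]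
      exact hE.memLp_two_mul hJ hj _ _ _ _)
    (fun t s ↦ by
      simp only [crossCorr_apply]
      rw [(hE.isserlis hJ hj).2, hsub (t + τ) t τ _ _ (by ring), hsub (s + τ) s τ _ _ (by ring),
        hsub (t + τ) (s + τ) (t - s) _ _ (by ring), hsub t s (t - s) _ _ rfl,
        hsub (t + τ) s (t - s + τ) _ _ (by ring), hsub t (s + τ) (t - s - τ) _ _ (by ring)]
      simp only [hR, hC]
      ring)
    hRint
  have hlim' : Tendsto (fun T : ℝ => eLpNorm (fun w => ((empAutocorr E T τ w a b : ℝ) : ℂ) -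
      ((C a b τ : ℝ) : ℂ)) 2 P) atTop (𝓝 0) := by
    refine hlim.congr fun T ↦ eLpNorm_congr_norm_ae (ae_of_all _ fun w ↦ ?_)
    rw [← Complex.ofReal_sub, Complex.norm_real]
    rfl
  rw [hCτ]
  refine ⟨?_, fun T hT ↦ ?_, hvar, hlim', ?_⟩
  · simpa only [coherency_apply] using hcov.1
  · obtain ⟨h1, h2, h3⟩ := hmean T hT
    exact ⟨h1, h2, congrArg Complex.ofReal h3⟩
  · refine tendstoInMeasure_of_tendsto_eLpNorm two_ne_zero (fun T ↦ ?_)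
      aestronglyMeasurable_const hlim'
    have hm : StronglyMeasurable fun w ↦ empAutocorr E T τ w a b := by
      simp only [empAutocorr, Matrix.of_apply, intervalIntegral]
      exact ((StronglyMeasurable.integral_prod_left hX.stronglyMeasurable).sub
        (StronglyMeasurable.integral_prod_left hX.stronglyMeasurable)).const_mul _
    exact (Complex.continuous_ofReal.comp_stronglyMeasurable hm).aestronglyMeasurable
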